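/- Let $K$ be an associative (not necessarily commutative) ring with identity that is 2-torsion free ($2x=0$ implies $x=0$), let $J$ be a two-sided ideal of $K$, and let $n\ge 4$. Let $R=R_n(K,J)$ be the ring of all $n\times n$ matrices over $K$ whose entries on and above the main diagonal lie in $J$. Let $e_{i,j}$ denote the matrix units, and put $\mathrm{Ann}_K J=\{x\in K : xJ=Jx=0\}$. A derivation of $R$ is an additive map $D:R\to R$ with $D(XY)=D(X)Y+XD(Y)$; a Jordan derivation of $R$ is an additive map $\Delta:R\to R$ with $\Delta(XY+YX)=\Delta(X)Y+Y\Delta(X)+X\Delta(Y)+\Delta(Y)X$ for all $X,Y\in R$. Then every Jordan derivation $\Delta$ of $R$ has the form $\Delta=D+\Omega$, where $D$ is a derivation of $R$ and $\Omega$ is an extremal Jordan derivation of $R$. Moreover, $D$ is the sum of a diagonal, an inner, an annihilator, a ring and an almost annihilator derivation of $R$. These terms have the following meaning. - An *extremal Jordan derivation* is a Jordan derivation given by additive maps $\alpha,\beta,\gamma:J\to\mathrm{Ann}_K J$ with $\alpha(J^2)=\beta(J^2)=\gamma(J^2)=0$ and $\alpha(yx)=x\alpha(y)$, $\beta(yx)=x\beta(y)$,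 $\beta(xy)=\beta(y)x$, $\gamma(xy)=\gamma(y)x$ for all $x\in K$, $y\in J$. It is the additive map with $ye_{1,n}\mapsto \alpha(y)e_{n-1,1}+\beta(y)e_{n-1,2}+\gamma(y)e_{n,2}$, $ye_{1,n-1}\mapsto \alpha(y)e_{n,1}+\beta(y)e_{n,2}$, $ye_{2,n-1}\mapsto \beta(y)e_{n,1}$, $ye_{2,n}\mapsto \beta(y)e_{n-1,1}+\gamma(y)e_{n,1}$ for $y\in J$, and $xe_{i,j}\mapsto 0$ for every other elementary matrix $xe_{i,j}\in R$. - An *inner derivation* is $X\mapsto AX-XA$ with $A\in R$. - A *diagonal derivation* is $X\mapsto dX-Xd$ with $d=\sum_{i=1}^n d_ie_{i,i}$, $d_i\in K$. - An *annihilator derivation* is $[a_{i,j}]\mapsto\bigl(\varsigma_n(a_{1,n})+\sum_{i=1}^{n-1}\varsigma_i(a_{i+1,i})\bigr)e_{n,1}$, where $\varsigma_n:J\to\mathrm{Ann}_K J$ and $\varsigma_i:K\to\mathrm{Ann}_K J$ $(1\le i\le n-1)$ are additive, $\varsigma_n(J^2)=0$ and $\varsigma_i(J)=0$ for $i<n$.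 - A *ring derivation* is $[a_{i,j}]\mapsto[\pi(a_{i,j})]$, where $\pi$ is a derivation of $K$ with $\pi(J)\subseteq J$. - An *almost annihilator derivation* is given by additive maps $a,b:J\to J$ and $c:J\to K$ with $a(xy)=xa(y)$, $b(yx)=b(y)x$, $c(y)z=yc(z)=c(yz)=0$ and $a(y)z+yb(z)=0$ for all $x\in K$, $y,z\in J$. It is the additive map with $ye_{1,n}\mapsto a(y)e_{1,1}+b(y)e_{n,n}+c(y)e_{n,1}$, $ye_{i,n}\mapsto a(y)e_{i,1}$ for $1<i\le n$, $ye_{1,j}\mapsto b(y)e_{n,j}$ for $1\le j<n$ $(y\in J)$, and $xe_{i,j}\mapsto 0$ for every other elementary matrix $xe_{i,j}\in R$. -/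

import Mathlib

namespace JordanDer

section General

variable {A : Type*} [NonUnitalRing A]

/-- Derivation of a (not necessarily unital, not necessarily commutative) ring: an additive map
satisfying the Leibniz rule. -/
def IsDerivation (D : A →+ A) : Prop :=
  ∀ x y : A, D (x * y) = D x * y + x * D y

/-- Jordan derivation: an additive map satisfying the Leibniz rule for `x ∘ y = x * y + y * x`. -/
def IsJordanDerivation (D : A →+ A) : Prop :=
  ∀ x y : A, D (x * y + y * x) = (D x * y + y * D x) + (x * D y + D y * x)

end General

variable {K : Type*} [Ring K]

/-- The two-sided annihilator `Ann_K J = {x ∈ K | x J = J x = 0}`, as an additive subgroup. -/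
def annK (J : Ideal K) : AddSubgroup K where
  carrier := {x | ∀ y ∈ J, x * y = 0 ∧ y * x = 0}
  zero_mem' := fun y _ => ⟨zero_mul y, mul_zero y⟩
  add_mem' := fun {a b} ha hb y hy => by
    simp [add_mul, mul_add, (ha y hy).1, (ha y hy).2, (hb y hy).1, (hb y hy).2]
  neg_mem' := fun {a} ha y hy => by
    simp [(ha y hy).1, (ha y hy).2]

/-- The ring `R_n(K, J)` of all `n × n` matrices over `K` whose entries on and above the main
diagonal lie in the two-sided ideal `J`. -/
def R (n : ℕ) (J : Ideal K) [J.IsTwoSided] : NonUnitalSubring (Matrix (Fin n) (Fin n) K) where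
  carrier := {X | ∀ i j, i ≤ j → X i j ∈ J}
  zero_mem' := fun _ _ _ => J.zero_mem
  add_mem' := fun hX hY i j h => J.add_mem (hX i j h) (hY i j h)
  neg_mem' := fun hX i j h => J.neg_mem (hX i j h)
  mul_mem' := fun {X Y} hX hY i j h => by
    rw [Matrix.mul_apply]
    refine J.sum_mem fun k _ => ?_
    rcases le_total i k with hk | hk
    · exact J.mul_mem_right _ (hX i k hk)
    · exact J.mul_mem_left _ (hY k j (hk.trans h))

section Maps

variable {n : ℕ} {J : Ideal K} [J.IsTwoSided]

/-- An entry on or above the diagonal of `X ∈ R_n(K, J)`, as an element of `J`. -/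
def entryJ (X : R n J) (i j : Fin n) (h : i ≤ j) : J := ⟨X.1 i j, X.2 i j h⟩

/-- For `y ∈ J` and `x ∈ K`, the product `y x` as an element of `J`. -/
def mulR (y : J) (x : K) : J := ⟨y.1 * x, J.mul_mem_right x y.2⟩

/-- For `x ∈ K` and `y ∈ J`, the product `x y` as an element of `J`. -/
def mulL (x : K) (y : J) : J := ⟨x * y.1, J.mul_mem_left x y.2⟩

/-- Inner derivation `X ↦ A X - X A` with `A ∈ R_n(K, J)`. -/
def IsInnerDerivation (D : R n J →+ R n J) : Prop :=
  IsDerivation D ∧ ∃ A : R n J, ∀ X : R n J, D X = A * X - X * A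

/-- Diagonal derivation `X ↦ d X - X d` with `d` a diagonal matrix over `K`
(`d` itself need not lie in `R_n(K, J)`). -/
def IsDiagonalDerivation (D : R n J →+ R n J) : Prop :=
  IsDerivation D ∧ ∃ d : Fin n → K, ∀ X : R n J,
    (D X : Matrix (Fin n) (Fin n) K) =
      Matrix.diagonal d * (X : Matrix (Fin n) (Fin n) K) -
        (X : Matrix (Fin n) (Fin n) K) * Matrix.diagonal d

/-- Ring derivation: the entrywise application of a derivation `π` of `K` that restricts to a
derivation of `J`, i.e. `π J ⊆ J`. -/
def IsRingInducedDerivation (D : R n J →+ R n J) : Prop :=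
  IsDerivation D ∧ ∃ π : K →+ K, IsDerivation π ∧ (∀ y ∈ J, π y ∈ J) ∧
    ∀ X : R n J, (D X : Matrix (Fin n) (Fin n) K) = (X : Matrix (Fin n) (Fin n) K).map π

variable (hn : 4 ≤ n)

/-! The four boundary indices. In the usual numbering `1, …, n` of rows and columns these are
`1`, `2`, `n - 1` and `n`; they are pairwise distinct because `4 ≤ n`. -/

/-- Index `1`. -/
def ixOne : Fin n := ⟨0, by omega⟩

/-- Index `2`. -/
def ixTwo : Fin n := ⟨1, by omega⟩

/-- Index `n - 1`. -/
def ixPred : Fin n := ⟨n - 2, by omega⟩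

/-- Index `n`. -/
def ixLast : Fin n := ⟨n - 1, by omega⟩

theorem ixOne_le (j : Fin n) : ixOne hn ≤ j := Nat.zero_le _

theorem le_ixLast (i : Fin n) : i ≤ ixLast hn := by
  have := i.2
  simp only [Fin.le_def, ixLast]
  omega

theorem ixTwo_le_ixPred : ixTwo hn ≤ ixPred hn := by
  simp only [Fin.le_def, ixTwo, ixPred]
  omega

/-- Annihilator derivation
`[a_{i,j}] ↦ (ς_n (a_{1,n}) + ∑_{i=1}^{n-1} ς_i (a_{i+1,i})) e_{n,1}`, where `ς_n : J → Ann_K J`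
and `ς_i : K → Ann_K J` (`i < n`) are additive with `ς_n (J²) = 0` and `ς_i (J) = 0`. Here `s i`
(`i` counted from zero) is `ς_{i+1}` and `t` is `ς_n`. -/
def IsAnnihilatorDerivation (D : R n J →+ R n J) : Prop :=
  IsDerivation D ∧
  ∃ (t : J →+ annK J) (s : Fin (n - 1) → (K →+ annK J)),
    (∀ y z : J, t (mulR y z) = 0) ∧
    (∀ i, ∀ y ∈ J, s i y = 0) ∧
    ∀ X : R n J, (D X : Matrix (Fin n) (Fin n) K) =
      Matrix.single (ixLast hn) (ixOne hn)
        ((t (entryJ X (ixOne hn) (ixLast hn) (ixOne_le hn _)) : K) +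
          ∑ i : Fin (n - 1),
            (s i (X.1 ⟨i.1 + 1, by omega⟩ ⟨i.1, by omega⟩) : K))

/-- Almost annihilator derivation: the additive map with
`y e_{1,n} ↦ a(y) e_{1,1} + b(y) e_{n,n} + c(y) e_{n,1}`,
`y e_{i,n} ↦ a(y) e_{i,1}` for `1 < i ≤ n`, `y e_{1,j} ↦ b(y) e_{n,j}` for `1 ≤ j < n`, and
zero on the other elementary matrices. Hence on a matrix `X` it is
`∑ᵢ a(X_{i,n}) e_{i,1} + ∑ⱼ b(X_{1,j}) e_{n,j} + c(X_{1,n}) e_{n,1}`. -/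
def IsAlmostAnnihilatorDerivation (D : R n J →+ R n J) : Prop :=
  IsDerivation D ∧
  ∃ (a b : J →+ J) (c : J →+ K),
    (∀ (x : K) (y : J), (a (mulL x y) : K) = x * a y) ∧
    (∀ (y : J) (x : K), (b (mulR y x) : K) = b y * x) ∧
    (∀ y z : J, c y * z = 0 ∧ (y : K) * c z = 0 ∧ c (mulR y z) = 0) ∧
    (∀ y z : J, (a y : K) * z + y * b z = 0) ∧
    ∀ X : R n J, (D X : Matrix (Fin n) (Fin n) K) =
      ∑ i, Matrix.single i (ixOne hn) (a (entryJ X i (ixLast hn) (le_ixLast hn i)) : K) +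
      ∑ j, Matrix.single (ixLast hn) j (b (entryJ X (ixOne hn) j (ixOne_le hn j)) : K) +
      Matrix.single (ixLast hn) (ixOne hn)
        (c (entryJ X (ixOne hn) (ixLast hn) (ixOne_le hn _)))

/-- Extremal Jordan derivation: the additive map with
`y e_{1,n}   ↦ α(y) e_{n-1,1} + β(y) e_{n-1,2} + γ(y) e_{n,2}`,
`y e_{1,n-1} ↦ α(y) e_{n,1} + β(y) e_{n,2}`,
`y e_{2,n-1} ↦ β(y) e_{n,1}`,
`y e_{2,n}   ↦ β(y) e_{n-1,1} + γ(y) e_{n,1}`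
and zero on the other elementary matrices. The four lines of the formula below are the
contributions of the entries `X_{1,n}`, `X_{1,n-1}`, `X_{2,n-1}`, `X_{2,n}`. -/
def IsExtremalJordanDerivation (Ω : R n J →+ R n J) : Prop :=
  IsJordanDerivation Ω ∧
  ∃ α β γ : J →+ annK J,
    (∀ y z : J, α (mulR y z) = 0 ∧ β (mulR y z) = 0 ∧ γ (mulR y z) = 0) ∧
    (∀ (x : K) (y : J),
      (α (mulR y x) : K) = x * α y ∧
      (β (mulR y x) : K) = x * β y ∧
      (β (mulL x y) : K) = β y * x ∧
      (γ (mulL x y) : K) = γ y * x) ∧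
    ∀ X : R n J,
      let y1n : J := entryJ X (ixOne hn) (ixLast hn) (ixOne_le hn _)
      let y1p : J := entryJ X (ixOne hn) (ixPred hn) (ixOne_le hn _)
      let y2p : J := entryJ X (ixTwo hn) (ixPred hn) (ixTwo_le_ixPred hn)
      let y2n : J := entryJ X (ixTwo hn) (ixLast hn) (le_ixLast hn _)
      (Ω X : Matrix (Fin n) (Fin n) K) =
        (Matrix.single (ixPred hn) (ixOne hn) (α y1n : K) +
          Matrix.single (ixPred hn) (ixTwo hn) (β y1n : K) +
          Matrix.single (ixLast hn) (ixTwo hn) (γ y1n : K)) +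
        (Matrix.single (ixLast hn) (ixOne hn) (α y1p : K) +
          Matrix.single (ixLast hn) (ixTwo hn) (β y1p : K)) +
        Matrix.single (ixLast hn) (ixOne hn) (β y2p : K) +
        (Matrix.single (ixPred hn) (ixOne hn) (β y2n : K) +
          Matrix.single (ixLast hn) (ixOne hn) (γ y2n : K))

end Maps

end JordanDer

namespace JordanDer

/-! Number the indices 1, ..., n; in the lemmas `o`, `w`, `p`, `m` stand for 1, 2, n-1, n. Since 2
is not a zero divisor, a Jordan derivation also respects the triple products XYZ + ZYX
(`jordan_triple`). Jordan and triple products build all elementary matrices of R from the x e_{i,j}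
with j < i and the y e_{1,n} with y in J, so a Jordan derivation is determined by its values on
these (`eq_zero_of_img`). The proof subtracts derivations of the listed types until these values can
be read off.

An inner and a diagonal derivation remove enough entries (`exists_normalization`) for the relations
among the units e_{i,j}, j < i, to kill all their images except some entries (n,1)
(`UnitRelations.eq_zero`). Comparing the factorisations x e_{i,l} = (x e_{i,j}) e_{j,l} = e_{i,j} (x
e_{j,l}) then shows that x e_{i,j} goes to π(x) e_{i,j} with one derivation π of K, plus a corner
term ς_j(x) e_{n,1} when i = j + 1 (`IsNormalized.img_lower`). These are a ring and an annihilator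
derivation.

After their removal only the images of y e_{1,n} matter, and these live on six positions. The
entries (1,1), (n,n), (n,1) are the maps a, b, c of an almost annihilator derivation; the entries
(n-1,1), (n-1,2), (n,2) are the maps α, β, γ of an extremal one. The required identities come from
products of y e_{1,n} with a few elementary matrices. The extremal part satisfies Ω(XY) = Ω(Y)X +
YΩ(X) (`extremal_mul`), the Leibniz rule with the factors reversed, hence is a Jordan derivation. -/

theorem not_le_imp {K : Type*} [Ring K] {n : ℕ} {J : Ideal K} {i j : Fin n} (h : j < i) (x : K) :
    i ≤ j → x ∈ J :=
  fun h' => absurd h' (not_le.mpr h)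

/-! ### Jordan and triple identities on elementary matrices. -/

section Basics

variable {K : Type*} [Ring K] {n : ℕ} {J : Ideal K} [J.IsTwoSided]

/-- The elementary matrix `x e_{i,j}` as an element of `R n J`. -/
def elem (i j : Fin n) (x : K) (h : i ≤ j → x ∈ J) : R n J :=
  ⟨Matrix.single i j x, fun a b hab => by
    rw [Matrix.single_apply]
    split_ifs with hc
    · obtain ⟨rfl, rfl⟩ := hc
      exact h hab
    · exact J.zero_mem⟩

@[simp] theorem coe_elem (i j : Fin n) (x : K) (h : i ≤ j → x ∈ J) :
    (elem i j x h : Matrix (Fin n) (Fin n) K) = Matrix.single i j x := rfl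

open Classical in
/-- The image of the elementary matrix `x e_{i,j}` under an additive map, as a matrix over `K`
(zero if `x e_{i,j}` does not belong to `R n J`). -/
noncomputable def img (T : R n J →+ R n J) (i j : Fin n) (x : K) : Matrix (Fin n) (Fin n) K :=
  if h : i ≤ j → x ∈ J then (T (elem i j x h) : Matrix (Fin n) (Fin n) K) else 0

theorem img_eq (T : R n J →+ R n J) {i j : Fin n} {x : K} (h : i ≤ j → x ∈ J) :
    img T i j x = (T (elem i j x h) : Matrix (Fin n) (Fin n) K) := dif_pos h

theorem img_mem (T : R n J →+ R n J) (i j : Fin n) (x : K) {a b : Fin n} (hab : a ≤ b) :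
    img T i j x a b ∈ J := by
  unfold img
  split_ifs with h
  · exact (T (elem i j x h)).2 a b hab
  · exact J.zero_mem

theorem img_sub_map (T S : R n J →+ R n J) (i j : Fin n) (x : K) :
    img (T - S) i j x = img T i j x - img S i j x := by
  unfold img
  split_ifs <;> simp

theorem img_add (T : R n J →+ R n J) {i j : Fin n} {x y : K} (hx : i ≤ j → x ∈ J)
    (hy : i ≤ j → y ∈ J) : img T i j (x + y) = img T i j x + img T i j y := by
  have e : elem i j (x + y) (fun h => J.add_mem (hx h) (hy h)) = elem i j x hx + elem i j y hy :=
    Subtype.ext (Matrix.single_add i j x y)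
  rw [img_eq T hx, img_eq T hy, img_eq T (fun h => J.add_mem (hx h) (hy h)), e, map_add]
  rfl

theorem mul_single_apply' (M : Matrix (Fin n) (Fin n) K) (k l a b : Fin n) (x : K) :
    (M * Matrix.single k l x) a b = if b = l then M a k * x else 0 := by
  split_ifs with h
  · subst h; simp
  · exact Matrix.mul_single_apply_of_ne _ _ _ _ _ h _

theorem single_mul_apply' (M : Matrix (Fin n) (Fin n) K) (k l a b : Fin n) (x : K) :
    (Matrix.single k l x * M) a b = if a = k then x * M l b else 0 := by
  split_ifs with h
  · subst h; simp
  · exact Matrix.single_mul_apply_of_ne _ _ _ _ _ h _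

theorem jordan_coe {T : R n J →+ R n J} (hT : IsJordanDerivation T) (X Y : R n J) :
    (T (X * Y + Y * X) : Matrix (Fin n) (Fin n) K) =
      T X * Y.1 + Y.1 * T X + X.1 * T Y + (T Y : Matrix (Fin n) (Fin n) K) * X.1 := by
  rw [hT X Y]
  simp [add_assoc]

/-- The entry (a,b) of the Jordan identity for two elementary matrices whose products vanish in both
orders. Most later relations are this one, or `img_jordan_mul`, at a well chosen position. -/
theorem img_jordan_zero {T : R n J →+ R n J} (hT : IsJordanDerivation T) {i j k l : Fin n}
    {x z : K} (hx : i ≤ j → x ∈ J) (hz : k ≤ l → z ∈ J) (hjk : j ≠ k) (hli : l ≠ i)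
    (a b : Fin n) :
    (if b = l then img T i j x a k * z else 0) + (if a = k then z * img T i j x l b else 0) +
      (if a = i then x * img T k l z j b else 0) + (if b = j then img T k l z a i * x else 0)
      = 0 := by
  have h := jordan_coe hT (elem i j x hx) (elem k l z hz)
  have h0 : elem i j x hx * elem k l z hz + elem k l z hz * elem i j x hx = 0 := by
    apply Subtype.ext
    simp [Matrix.single_mul_single_of_ne, hjk, hli]
  rw [h0, map_zero, ← img_eq, ← img_eq] at h
  have h' := congrFun (congrFun h a) b
  simpa [Matrix.add_apply, mul_single_apply', single_mul_apply', eq_comm (a := (0 : K))] using h'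

theorem img_jordan_mul {T : R n J →+ R n J} (hT : IsJordanDerivation T) {i j l : Fin n}
    {x z : K} (hx : i ≤ j → x ∈ J) (hz : j ≤ l → z ∈ J) (hxz : i ≤ l → x * z ∈ J) (hli : l ≠ i)
    (a b : Fin n) :
    img T i l (x * z) a b =
    (if b = l then img T i j x a j * z else 0) + (if a = j then z * img T i j x l b else 0) +
      (if a = i then x * img T j l z j b else 0) + (if b = j then img T j l z a i * x else 0) := by
  have h := jordan_coe hT (elem i j x hx) (elem j l z hz)
  have h0 : elem i j x hx * elem j l z hz + elem j l z hz * elem i j x hx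
      = elem i l (x * z) hxz := by
    apply Subtype.ext
    simp [Matrix.single_mul_single_of_ne, hli]
  rw [h0, ← img_eq, ← img_eq, ← img_eq] at h
  have h' := congrFun (congrFun h a) b
  simpa [Matrix.add_apply, mul_single_apply', single_mul_apply'] using h'

/-- With X∘Y = XY + YX one has 2(XYZ + ZYX) = (X∘Y)∘Z + X∘(Y∘Z) - Y∘(X∘Z). Both sides are expanded
by the Jordan rule, and the factor 2 is cancelled entrywise. -/
theorem jordan_triple (h2 : ∀ x : K, 2 * x = 0 → x = 0) {T : R n J →+ R n J}
    (hT : IsJordanDerivation T) (X Y Z : R n J) :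
    T (X * Y * Z + Z * Y * X) = T X * Y * Z + X * T Y * Z + X * Y * T Z +
      (T Z * Y * X + Z * T Y * X + Z * Y * T X) := by
  have e1 := hT (X * Y + Y * X) Z
  have e2 := hT X (Y * Z + Z * Y)
  have e3 := hT Y (X * Z + Z * X)
  rw [hT X Y] at e1
  rw [hT Y Z] at e2
  rw [hT X Z] at e3
  have key : T (X * Y * Z + Z * Y * X) + T (X * Y * Z + Z * Y * X) =
      (T X * Y * Z + X * T Y * Z + X * Y * T Z +
      (T Z * Y * X + Z * T Y * X + Z * Y * T X)) + (T X * Y * Z + X * T Y * Z + X * Y * T Z +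
      (T Z * Y * X + Z * T Y * X + Z * Y * T X)) := by
    rw [← map_add]
    have : X * Y * Z + Z * Y * X + (X * Y * Z + Z * Y * X) =
      ((X * Y + Y * X) * Z + Z * (X * Y + Y * X)) + (X * (Y * Z + Z * Y) + (Y * Z + Z * Y) * X)
        - (Y * (X * Z + Z * X) + (X * Z + Z * X) * Y) := by noncomm_ring
    rw [this, map_sub, map_add, e1, e2, e3]
    noncomm_ring
  have tf : ∀ A B : R n J, A + A = B + B → A = B := by
    intro A B h
    apply Subtype.ext
    ext i j
    have h' := congrFun (congrFun (congrArg Subtype.val h) i) j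
    have : (A.1 i j - B.1 i j) = 0 := h2 _ (by
      have h'' : A.1 i j + A.1 i j = B.1 i j + B.1 i j := h'
      rw [two_mul, sub_add_sub_comm, h'', sub_self])
    exact sub_eq_zero.mp this
  exact tf _ _ key

theorem single_mul_mul_single (M : Matrix (Fin n) (Fin n) K) (i j k l : Fin n) (x z : K) :
    Matrix.single i j x * M * Matrix.single k l z = Matrix.single i l (x * M j k * z) := by
  ext a b
  rw [mul_single_apply', single_mul_apply', Matrix.single_apply]
  grind

theorem eq_sum_elem (X : R n J) : X = ∑ i, ∑ j, elem i j (X.1 i j) (X.2 i j) := by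
  apply Subtype.ext
  simp only [AddSubmonoidClass.coe_finsetSum, coe_elem]
  exact Matrix.matrix_eq_sum_single X.1

theorem eq_of_img_eq {T S : R n J →+ R n J}
    (h : ∀ i j x, (i ≤ j → x ∈ J) → img T i j x = img S i j x) : T = S := by
  ext1 X
  rw [eq_sum_elem X, map_sum, map_sum]
  refine Finset.sum_congr rfl fun i _ => ?_
  rw [map_sum, map_sum]
  refine Finset.sum_congr rfl fun j _ => ?_
  apply Subtype.ext
  rw [← img_eq, ← img_eq, h _ _ _ (X.2 i j)]

/-- The linearised triple identity on elementary matrices, for the middle factor `y e_{p,q}`. -/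
theorem img_triple (h2 : ∀ x : K, 2 * x = 0 → x = 0) {T : R n J →+ R n J}
    (hT : IsJordanDerivation T) {i j p q k l : Fin n} {x y z : K} (hx : i ≤ j → x ∈ J)
    (hy : p ≤ q → y ∈ J) (hz : k ≤ l → z ∈ J) :
    (T (elem i j x hx * elem p q y hy * elem k l z hz +
        elem k l z hz * elem p q y hy * elem i j x hx) : Matrix (Fin n) (Fin n) K) =
      img T i j x * Matrix.single p q y * Matrix.single k l z +
      Matrix.single i l (x * img T p q y j k * z) +
      Matrix.single i j x * Matrix.single p q y * img T k l z +
      (img T k l z * Matrix.single p q y * Matrix.single i j x +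
      Matrix.single k j (z * img T p q y l i * x) +
      Matrix.single k l z * Matrix.single p q y * img T i j x) := by
  rw [jordan_triple h2 hT, ← single_mul_mul_single, ← single_mul_mul_single, img_eq T hx,
    img_eq T hy, img_eq T hz]
  simp

/-- The image of `y e_{i,l} = e_{i,1} (y e_{1,n}) e_{n,l}`; here `o` and `m` play the roles of the
indices `1` and `n`. -/
theorem img_sandwich (h2 : ∀ x : K, 2 * x = 0 → x = 0) {T : R n J →+ R n J}
    (hT : IsJordanDerivation T) {o m i l : Fin n} (hoi : o < i) (hlm : l < m)
    (him : ¬ (i = m ∧ l = o)) {y : K} (hy : y ∈ J) :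
    img T i l y =
      img T i o 1 * Matrix.single o m y * Matrix.single m l 1 +
      Matrix.single i l (img T o m y o m) +
      Matrix.single i o 1 * Matrix.single o m y * img T m l 1 +
      (img T m l 1 * Matrix.single o m y * Matrix.single i o 1 +
      Matrix.single m o (img T o m y l i) +
      Matrix.single m l 1 * Matrix.single o m y * img T i o 1) := by
  have h := img_triple h2 hT (not_le_imp (J := J) hoi 1) (fun _ : o ≤ m => hy)
    (not_le_imp (J := J) hlm 1)
  have e : elem i o 1 (not_le_imp (J := J) hoi 1) * elem o m y (fun _ : o ≤ m => hy) *
      elem m l 1 (not_le_imp (J := J) hlm 1) + elem m l 1 (not_le_imp (J := J) hlm 1) *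
      elem o m y (fun _ : o ≤ m => hy) * elem i o 1 (not_le_imp (J := J) hoi 1) =
      elem i l y (fun _ => hy) := by
    apply Subtype.ext
    -- The product in reverse order survives only when l = 1 and i = n hold together, which `him`
    -- excludes.
    by_cases hlo : l = o
    · have : m ≠ i := fun h => him ⟨h.symm, hlo⟩
      simp [this]
    · simp [Matrix.single_mul_single_of_ne, hlo]
  rw [e, ← img_eq] at h
  simpa using h

/-- A Jordan derivation vanishing on the strictly lower triangular elementary matrices and on
`J e_{1,n}` is zero. -/
theorem eq_zero_of_img (h2 : ∀ x : K, 2 * x = 0 → x = 0) (hn : 3 ≤ n) {T : R n J →+ R n J}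
    (hT : IsJordanDerivation T) {o m : Fin n} (ho : o.1 = 0) (hm : m.1 = n - 1)
    (hlow : ∀ i j x, j < i → img T i j x = 0) (htop : ∀ y ∈ J, img T o m y = 0) : T = 0 := by
  have hwn : 1 < n := by omega
  have hw : (⟨1, hwn⟩ : Fin n).1 = 1 := rfl
  generalize (⟨1, hwn⟩ : Fin n) = w at hw
  have how : o < w := by rw [Fin.lt_def]; omega
  have hwm : w < m := by rw [Fin.lt_def]; omega
  apply eq_of_img_eq
  intro i l y hy
  have h0 : img (0 : R n J →+ R n J) i l y = 0 := by unfold img; split_ifs; all_goals rfl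
  rw [h0]
  rcases lt_or_ge l i with hli | hil
  · exact hlow _ _ _ hli
  have hyJ := hy hil
  by_cases hi : i = o
  · by_cases hl : l = m
    · rw [hi, hl]; exact htop y hyJ
    · have hlm : l < m := by
        have : l.1 ≠ m.1 := fun h => hl (Fin.ext h)
        rw [Fin.lt_def]; omega
      subst hi
      -- The Jordan product of y e_{1,n} and e_{n,1} yields y e_{1,1} and y e_{n,n} at once. The
      -- detour e_{1,n} e_{n,2} e_{2,1} isolates the first; the case of y e_{n,n} below is
      -- symmetric.
      by_cases hlo : l = i
      · subst hlo
        have h := img_triple h2 hT (fun _ : l ≤ m => hyJ) (not_le_imp (J := J) hwm 1)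
          (not_le_imp (J := J) how 1)
        rw [htop y hyJ, hlow _ _ _ hwm, hlow _ _ _ how] at h
        have e : elem l m y (fun _ => hyJ) * elem m w 1 (not_le_imp (J := J) hwm 1) *
            elem w l 1 (not_le_imp (J := J) how 1) + elem w l 1 (not_le_imp (J := J) how 1) *
            elem m w 1 (not_le_imp (J := J) hwm 1) * elem l m y (fun _ => hyJ) =
            elem l l y hy := by
          apply Subtype.ext
          simp [Matrix.single_mul_single_of_ne, hlm.ne]
        rw [e, ← img_eq] at h
        simpa using h
      · have h := img_jordan_mul hT (fun _ : i ≤ m => hyJ) (not_le_imp (J := J) hlm 1)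
          (fun _ => by simpa using hyJ) hlo
        rw [htop y hyJ, hlow _ _ _ hlm] at h
        ext a b
        simpa using h a b
  · have hoi : o < i := by
      have : i.1 ≠ o.1 := fun h => hi (Fin.ext h)
      rw [Fin.lt_def]; omega
    by_cases hl : l = m
    · subst hl
      by_cases him : i = l
      · subst him
        have h := img_triple h2 hT (not_le_imp (J := J) hwm 1) (not_le_imp (J := J) how 1)
          (fun _ : o ≤ i => hyJ)
        rw [htop y hyJ, hlow _ _ _ hwm, hlow _ _ _ how] at h
        have e : elem i w 1 (not_le_imp (J := J) hwm 1) * elem w o 1 (not_le_imp (J := J) how 1) *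
            elem o i y (fun _ => hyJ) + elem o i y (fun _ => hyJ) *
            elem w o 1 (not_le_imp (J := J) how 1) * elem i w 1 (not_le_imp (J := J) hwm 1) =
            elem i i y hy := by
          apply Subtype.ext
          simp [Matrix.single_mul_single_of_ne, hwm.ne']
        rw [e, ← img_eq] at h
        simpa using h
      · have h := img_jordan_mul hT (not_le_imp (J := J) hoi 1) (fun _ : o ≤ l => hyJ)
          (fun _ => by simpa using hyJ) (Ne.symm him)
        rw [htop y hyJ, hlow _ _ _ hoi] at h
        ext a b
        simpa using h a b
    · have hlm : l < m := by
        have : l.1 ≠ m.1 := fun h => hl (Fin.ext h)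
        rw [Fin.lt_def]; omega
      rw [img_sandwich h2 hT hoi hlm (fun h => by
        rw [h.1, h.2, Fin.le_def] at hil; omega) hyJ, hlow _ _ _ hoi, hlow _ _ _ hlm, htop y hyJ]
      simp

end Basics

/-! ### Images of the matrix units below the diagonal. -/

section Units

variable {K : Type*} [Ring K] {n : ℕ}

/-- The relations between the images `U i j` of the matrix units `e_{i,j}`, `j < i`, under a
Jordan derivation. -/
structure UnitRelations (U : Fin n → Fin n → Matrix (Fin n) (Fin n) K) : Prop where
  zero : ∀ {i j k l : Fin n}, j < i → l < k → j ≠ k → l ≠ i → ∀ a b,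
    (if b = l then U i j a k else 0) + (if a = k then U i j l b else 0) +
      (if a = i then U k l j b else 0) + (if b = j then U k l a i else 0) = 0
  mul : ∀ {i j l : Fin n}, j < i → l < j → ∀ a b,
    U i l a b = (if b = l then U i j a j else 0) + (if a = j then U i j l b else 0) +
      (if a = i then U j l j b else 0) + (if b = j then U j l a i else 0)

theorem unitRelations_img {J : Ideal K} [J.IsTwoSided] {T : R n J →+ R n J}
    (hT : IsJordanDerivation T) : UnitRelations fun i j => img T i j 1 where
  zero hij hkl hjk hli a b := by
    simpa using img_jordan_zero hT (not_le_imp hij 1) (not_le_imp hkl 1) hjk hli a b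
  mul {i j l} hij hjl a b := by
    simpa using img_jordan_mul hT (not_le_imp hij 1) (not_le_imp hjl 1)
      (not_le_imp (hjl.trans hij) _) (hjl.trans hij).ne a b

variable {U : Fin n → Fin n → Matrix (Fin n) (Fin n) K}

/-- Pairing e_{i,j} with e_{k,1}, whose image has zero first column, leaves only -s on the diagonal
outside the first column, where s is the entry (1,1). Since e_{i,j} squares to zero, 4s = 0. -/
theorem UnitRelations.off_column (hU : UnitRelations U) (h2 : ∀ x : K, 2 * x = 0 → x = 0)
    {o : Fin n} (ho : o.1 = 0) (hcol : ∀ k, o < k → ∀ a, U k o a o = 0)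
    {i j k : Fin n} (hoj : o < j) (hji : j < i) (hok : o < k) (a : Fin n) :
    U i j a k = 0 ∧ U i j o o = 0 := by
  have key : ∀ {i j k : Fin n}, o < j → j < i → o < k → ∀ a,
      U i j a k = if a = k then - U i j o o else 0 := by
    intro i j k hoj hji hok a
    by_cases hkj : k = j
    · subst hkj
      have h1 := hU.mul hji hoj a o
      have h3 := hcol i (hoj.trans hji) a
      have h4 := hcol k hoj k
      grind
    · have h1 := hU.zero hji hok (Ne.symm hkj) (hoj.trans hji).ne a o
      have h4 := hcol k hok j
      grind
  have hs : U i j o o = 0 := by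
    have h1 := hU.zero hji hji hji.ne hji.ne i j
    have h3 := key hoj hji hoj j
    have h4 := key hoj hji (hoj.trans hji) i
    simp only [if_true] at h1 h3 h4
    apply h2
    apply h2
    rw [h3, h4] at h1
    have : (2 : K) * (2 * U i j o o) =
      -(-U i j o o + -U i j o o + -U i j o o + -U i j o o) := by noncomm_ring
    rw [this, h1, neg_zero]
  refine ⟨?_, hs⟩
  rw [key hoj hji hok a, hs]
  simp

/-- The products of e_{i,1} and e_{k,1} vanish, so the column k of the one image is minus the column
i of the other. The factorisation e_{b,1} = e_{b,2} e_{2,1} gives the same relation with the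
opposite sign for the image of e_{2,1}, which is therefore zero; the other e_{k,1} factor through
e_{2,1}. -/
theorem UnitRelations.first_column (hU : UnitRelations U) (h2 : ∀ x : K, 2 * x = 0 → x = 0)
    {o : Fin n} (ho : o.1 = 0) (hcol : ∀ k, o < k → ∀ a, U k o a o = 0)
    {k : Fin n} (hok : o < k) : U k o = 0 := by
  have h2' : ∀ x : K, x + x = 0 → x = 0 := fun x hx => h2 x (by rw [two_mul, hx])
  have anti : ∀ {i k : Fin n}, o < i → o < k → ∀ a, U i o a k + U k o a i = 0 := by
    intro i k hi hk a
    have h1 := hU.zero hi hk hk.ne hi.ne a o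
    have h3 := hcol i hi o
    have h4 := hcol k hk o
    grind
  have comp : ∀ {i j : Fin n}, o < j → j < i → ∀ a b, b ≠ o →
      U i o a b = (if a = i then U j o j b else 0) + (if b = j then U j o a i else 0) := by
    intro i j hoj hji a b hb
    have h1 := hU.mul hji hoj a b
    have hob : o < b := by
      have h5 : b.1 ≠ o.1 := fun h => hb (Fin.ext h)
      rw [Fin.lt_def]; omega
    have h3 := (hU.off_column h2 ho hcol hoj hji hob j).1
    have h6 := (hU.off_column h2 ho hcol hoj hji hob a).2
    have h7 := (hU.off_column h2 ho hcol hoj hji hob o).1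
    grind
  have hwn : 1 < n := by rw [Fin.lt_def] at hok; omega
  obtain ⟨w, hw⟩ : ∃ w : Fin n, w.1 = 1 := ⟨⟨1, hwn⟩, rfl⟩
  have how : o < w := by rw [Fin.lt_def]; omega
  have hW : ∀ a b, b ≠ o → U w o a b = 0 := by
    intro a b hb
    have hob : o < b := by
      have h5 : b.1 ≠ o.1 := fun h => hb (Fin.ext h)
      rw [Fin.lt_def]; omega
    by_cases hbw : b = w
    · subst hbw
      exact h2' _ (anti how how a)
    · have hwb : w < b := by
        have h5 : b.1 ≠ w.1 := fun h => hbw (Fin.ext h)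
        rw [Fin.lt_def] at hob ⊢; omega
      have h1 := anti how hob a
      have h3 := comp how hwb a w how.ne'
      have h4 := h2' _ (anti how how w)
      apply h2'
      rw [h3] at h1
      by_cases hab : a = b
      · subst hab
        simpa [h4] using h1
      · simpa [hab] using h1
  ext a b
  by_cases hb : b = o
  · rw [hb]; exact hcol k hok a
  · by_cases hkw : k = w
    · rw [hkw]; exact hW a b hb
    · have hwk : w < k := by
        have h5 : k.1 ≠ w.1 := fun h => hkw (Fin.ext h)
        rw [Fin.lt_def] at hok ⊢; omega
      rw [comp how hwk a b hb, hW _ _ hb]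
      have := hW a k hok.ne'
      simp [this]

/-- If the first columns of the `U k 1` vanish and so do the entries `(n, 1)` of the `U n a`, then
the only entries of the matrices `U i j` that may be nonzero are the entries `(n, 1)` of
`U (j + 1) j` with `1 < j` and `j + 1 < n`. -/
theorem UnitRelations.eq_zero (hU : UnitRelations U) (h2 : ∀ x : K, 2 * x = 0 → x = 0)
    {o m : Fin n} (ho : o.1 = 0) (hm : m.1 = n - 1) (hcol : ∀ k, o < k → ∀ a, U k o a o = 0)
    (hrow : ∀ a, o < a → a < m → U m a m o = 0) {i j : Fin n} (hji : j < i) (a b : Fin n)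
    (hab : a = m → b = o → i.1 = j.1 + 1 → i ≠ m → j = o) :
    U i j a b = 0 := by
  have h2' : ∀ x : K, x + x = 0 → x = 0 := fun x hx => h2 x (by rw [two_mul, hx])
  have hn := m.2
  rcases Nat.eq_zero_or_pos j.1 with hj0 | hj0
  · have hjo : j = o := Fin.ext (by omega)
    subst hjo
    rw [hU.first_column h2 ho hcol hji]; rfl
  have hoj : o < j := by rw [Fin.lt_def]; omega
  rcases Nat.eq_zero_or_pos b.1 with hb0 | hb0
  swap
  · exact (hU.off_column h2 ho hcol hoj hji (k := b) (by rw [Fin.lt_def]; omega) a).1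
  have hbo : b = o := Fin.ext (by omega)
  subst hbo
  have hz : ∀ {i j k l : Fin n}, b < j → j < i → b < l → l < k → j ≠ k → l ≠ i → ∀ a,
      (if a = k then U i j l b else 0) + (if a = i then U k l j b else 0) = 0 := by
    intro i j k l hj hji hl hlk hjk hli a
    have := hU.zero hji hlk hjk hli a b
    simpa [hj.ne, hl.ne] using this
  have hmul : ∀ {i j l : Fin n}, b < l → l < j → j < i → ∀ a,
      U i l a b = (if a = j then U i j l b else 0) + (if a = i then U j l j b else 0) := by
    intro i j l hl hlj hji a
    have := hU.mul hji hlj a b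
    simpa [hl.ne, (hl.trans hlj).ne] using this
  by_cases hai : a = i
  · subst hai
    by_cases ham : a = m
    · subst ham; exact hrow j hoj hji
    · have hlt : a < m := by
        have h5 : a.1 ≠ m.1 := fun h => ham (Fin.ext h)
        rw [Fin.lt_def]; omega
      -- By e_{n,j} = e_{n,i} e_{i,j}, the entry (i,1) for e_{i,j} equals the entry (n,1) for
      -- e_{n,j}, which is normalised to zero.
      have h1 := hmul hoj hji hlt m
      rw [hrow j hoj (hji.trans hlt)] at h1
      simpa [hlt.ne', eq_comm (a := (0 : K))] using h1
  rcases Nat.eq_zero_or_pos a.1 with ha0 | ha0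
  · have : a = b := Fin.ext (by omega)
    rw [this]
    exact (hU.off_column h2 ho hcol hoj hji hoj a).2
  have hba : b < a := by rw [Fin.lt_def]; omega
  by_cases ham : a = m
  · subst ham
    have h6 : i.1 ≠ j.1 + 1 := by
      intro h
      have := hab rfl rfl h (Ne.symm hai)
      rw [Fin.lt_def] at hoj
      rw [this] at hoj; omega
    have h7 : j.1 + 1 < n := by rw [Fin.lt_def] at hji; omega
    obtain ⟨t, ht⟩ : ∃ t : Fin n, t.1 = j.1 + 1 := ⟨⟨j.1 + 1, h7⟩, rfl⟩
    have hti : t < i := by rw [Fin.lt_def] at hji ⊢; omega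
    have h1 := hmul hoj (show j < t by rw [Fin.lt_def]; omega) hti a
    have hat : a ≠ t := by
      intro h; rw [h] at hm; rw [Fin.lt_def] at hti; omega
    simpa [hat, hai] using h1
  have hlt : a < m := by
    have h5 : a.1 ≠ m.1 := fun h => ham (Fin.ext h)
    rw [Fin.lt_def]; omega
  -- The unit e_{k,a} has zero products with e_{i,j}, and the entry (k,1) of this relation isolates
  -- the entry (a,1).
  have side : ∀ {j a k : Fin n}, b < j → j < i → b < a → a ≠ i → a < k → k ≠ i → j ≠ k →
      U i j a b = 0 := by
    intro j a k hbj hji hba hai hak hki hjk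
    have := hz hbj hji hba hak hjk hai k
    simpa [hki] using this
  by_cases him : i = m
  swap
  · exact side hoj hji hba hai hlt (Ne.symm him) (by rintro rfl; rw [Fin.lt_def] at hji; omega)
  subst him
  have anti : ∀ {j l : Fin n}, b < j → j < i → b < l → l < i → U i j l b + U i l j b = 0 := by
    intro j l hj hji hl hli
    have := hz hj hji hl hli hji.ne hli.ne i
    simpa using this
  -- For i = n and adjacent a, j, the choice k = max(a, j) in `side` is unavailable. Here
  -- antisymmetry and the factorisation e_{n,q} = e_{n,p} e_{p,q} give two relations of opposite
  -- sign.
  have step : ∀ {p q : Fin n}, b < q → q < p → p < i →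
      U i p q b = 0 ∧ U i q p b = 0 := by
    intro p q hq hqp hpi
    have h1 := hmul hq hqp hpi p
    have h3 := anti (hq.trans hqp) hpi hq (hqp.trans hpi)
    simp only [if_true, hpi.ne, if_false, add_zero] at h1
    rw [h1] at h3
    have h4 := h2' _ h3
    exact ⟨h4, h1.trans h4⟩
  rcases lt_trichotomy j a with h | h | h
  · by_cases h9 : a.1 = j.1 + 1
    · exact (step hoj h hlt).2
    · obtain ⟨t, ht⟩ : ∃ t : Fin n, t.1 = j.1 + 1 := ⟨⟨j.1 + 1, by omega⟩, rfl⟩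
      have h1 := anti hoj hji hba hlt
      have h3 : U i a j b = 0 := by
        rw [Fin.lt_def] at h hlt hji
        apply side hba (Fin.lt_def.mpr hlt) hoj (Fin.ne_of_lt hji) (k := t)
        · rw [Fin.lt_def]; omega
        · intro h5; rw [h5] at ht; omega
        · intro h5; rw [← h5] at ht; omega
      rwa [h3, add_zero] at h1
  · subst h
    exact h2' _ (anti hoj hji hoj hji)
  · by_cases h9 : j.1 = a.1 + 1
    · exact (step hba h hji).1
    · obtain ⟨t, ht⟩ : ∃ t : Fin n, t.1 = a.1 + 1 := ⟨⟨a.1 + 1, by omega⟩, rfl⟩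
      rw [Fin.lt_def] at h hlt hji
      apply side hoj (Fin.lt_def.mpr hji) hba hai (k := t)
      · rw [Fin.lt_def]; omega
      · intro h5; rw [h5] at ht; omega
      · intro h5; rw [← h5] at ht; omega

end Units

/-! ### Normalisation by an inner and a diagonal derivation. -/

section Commutator

variable {K : Type*} [Ring K] {n : ℕ} {J : Ideal K} [J.IsTwoSided]

/-- The map `X ↦ B X - X B` of `R n J`, for a matrix `B` over `K` normalising `R n J`. -/
def commutator (B : Matrix (Fin n) (Fin n) K) (hB : ∀ X ∈ R n J, B * X - X * B ∈ R n J) :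
    R n J →+ R n J where
  toFun X := ⟨B * X.1 - X.1 * B, hB X.1 X.2⟩
  map_zero' := Subtype.ext (by simp)
  map_add' X Y := Subtype.ext (by
    show B * (X.1 + Y.1) - (X.1 + Y.1) * B = (B * X.1 - X.1 * B) + (B * Y.1 - Y.1 * B)
    noncomm_ring)

@[simp] theorem coe_commutator (B : Matrix (Fin n) (Fin n) K)
    (hB : ∀ X ∈ R n J, B * X - X * B ∈ R n J) (X : R n J) :
    (commutator B hB X : Matrix (Fin n) (Fin n) K) = B * X.1 - X.1 * B := rfl

theorem isDerivation_commutator (B : Matrix (Fin n) (Fin n) K)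
    (hB : ∀ X ∈ R n J, B * X - X * B ∈ R n J) : IsDerivation (commutator B hB) := by
  intro X Y
  apply Subtype.ext
  show B * (X.1 * Y.1) - (X.1 * Y.1) * B =
    (B * X.1 - X.1 * B) * Y.1 + X.1 * (B * Y.1 - Y.1 * B)
  noncomm_ring

theorem commutator_mem_of_mem {A : Matrix (Fin n) (Fin n) K} (hA : A ∈ R n J) :
    ∀ X ∈ R n J, A * X - X * A ∈ R n J :=
  fun _ hX => (R n J).sub_mem ((R n J).mul_mem hA hX) ((R n J).mul_mem hX hA)

theorem commutator_diagonal_mem (d : Fin n → K) :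
    ∀ X ∈ R n J, Matrix.diagonal d * X - X * Matrix.diagonal d ∈ R n J := by
  intro X hX i j hij
  rw [Matrix.sub_apply, Matrix.diagonal_mul, Matrix.mul_diagonal]
  exact J.sub_mem (J.mul_mem_left _ (hX i j hij)) (J.mul_mem_right _ (hX i j hij))

theorem IsDerivation.isJordanDerivation {A : Type*} [NonUnitalRing A] {D : A →+ A}
    (hD : IsDerivation D) : IsJordanDerivation D := by
  intro x y
  rw [map_add, hD, hD]
  abel

theorem IsJordanDerivation.sub {A : Type*} [NonUnitalRing A] {D E : A →+ A}
    (hD : IsJordanDerivation D) (hE : IsJordanDerivation E) : IsJordanDerivation (D - E) := by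
  intro x y
  simp only [AddMonoidHom.sub_apply]
  rw [hD, hE]
  noncomm_ring

theorem IsDerivation.add {A : Type*} [NonUnitalRing A] {D E : A →+ A}
    (hD : IsDerivation D) (hE : IsDerivation E) : IsDerivation (D + E) := by
  intro x y
  simp only [AddMonoidHom.add_apply]
  rw [hD, hE]
  noncomm_ring

/-- Subtracting an inner and a diagonal derivation normalises the images of the matrix units. -/
theorem exists_normalization {T : R n J →+ R n J} (hT : IsJordanDerivation T)
    {o : Fin n} (ho : o.1 = 0) (m : Fin n) :
    ∃ Dinn Ddiag : R n J →+ R n J, IsInnerDerivation Dinn ∧ IsDiagonalDerivation Ddiag ∧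
      (∀ k, o < k → ∀ a, img (T - Dinn - Ddiag) k o 1 a o = 0) ∧
      (∀ a, o < a → a < m → img (T - Dinn - Ddiag) m a 1 m o = 0) := by
  -- For k > 1 the column k of A is the first column of the image of e_{k,1} without its entry
  -- (k,1). That entry need not lie in J, so it goes into `d`. The first column of A serves the
  -- second normalisation, on the e_{n,a}.
  let A : Matrix (Fin n) (Fin n) K := Matrix.of fun a k =>
    if k = o then (if a = o then 0 else - img T m a 1 m o)
    else if a = k then 0 else img T k o 1 a o
  let d : Fin n → K := fun k => if k = o then 0 else img T k o 1 k o
  have hA : A ∈ R n J := by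
    intro a k hak
    simp only [A, Matrix.of_apply]
    split_ifs with h1 h2 h3
    · exact J.zero_mem
    · exfalso; apply h2; apply Fin.ext; rw [Fin.le_def] at hak; rw [h1] at hak; omega
    · exact J.zero_mem
    · by_cases h4 : a = o
      · rw [h4]; exact img_mem T _ _ _ le_rfl
      · have h5 : a.1 ≠ o.1 := fun h => h4 (Fin.ext h)
        have hoa : o < a := by rw [Fin.lt_def]; omega
        have hk : a < k := lt_of_le_of_ne hak h3
        -- The entry (a,1) lies below the diagonal. Through e_{k,1} = e_{k,a} e_{a,1} it is the sum
        -- of two diagonal entries of the image of e_{k,a}, hence lies in J.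
        have := (unitRelations_img hT).mul hk hoa a o
        simp only [if_true, h3, if_false, add_zero, hoa.ne] at this
        rw [this]
        exact J.add_mem (img_mem T _ _ _ le_rfl) (img_mem T _ _ _ le_rfl)
  have himg : ∀ i j, j < i → ∀ a b, img (T - commutator A (commutator_mem_of_mem hA) -
      commutator (Matrix.diagonal d) (commutator_diagonal_mem d)) i j 1 a b =
      img T i j 1 a b - ((if b = j then A a i else 0) - (if a = i then A j b else 0)) -
        (if i = a ∧ j = b then d a - d b else 0) := by
    intro i j hij a b
    rw [img_sub_map, img_sub_map, img_eq _ (not_le_imp hij 1),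
      img_eq (commutator A _) (not_le_imp hij 1),
      img_eq (commutator (Matrix.diagonal d) _) (not_le_imp hij 1)]
    simp only [Matrix.sub_apply, coe_commutator, coe_elem, mul_single_apply', single_mul_apply',
      Matrix.diagonal_mul, Matrix.mul_diagonal, mul_one, one_mul]
    congr 1
    rw [Matrix.single_apply]
    split_ifs <;> simp
  refine ⟨commutator A (commutator_mem_of_mem hA),
    commutator (Matrix.diagonal d) (commutator_diagonal_mem d),
    ⟨isDerivation_commutator _ _, ⟨A, hA⟩, fun X => Subtype.ext rfl⟩,
    ⟨isDerivation_commutator _ _, d, fun X => rfl⟩, ?_, ?_⟩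
  · intro k hk a
    rw [himg _ _ hk]
    simp only [A, d, Matrix.of_apply]
    have := hk.ne'
    by_cases hak : a = k
    · subst hak; simp [this]
    · simp [this, hak, Ne.symm hak]
  · intro a hoa ham
    rw [himg _ _ ham]
    simp only [A, d, Matrix.of_apply]
    simp [hoa.ne, hoa.ne']

end Commutator

/-- The indices `o, w, p, m` are the first, the second, the last but one and the last one. -/
structure IsCorner {n : ℕ} (o w p m : Fin n) : Prop where
  hn : 4 ≤ n
  ho : o.1 = 0
  hw : w.1 = 1
  hp : p.1 = n - 2
  hm : m.1 = n - 1

namespace IsCorner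

variable {n : ℕ} {o w p m : Fin n}

theorem o_lt_w (h : IsCorner o w p m) : o < w := by
  rw [Fin.lt_def, h.ho, h.hw]; omega

theorem w_lt_p (h : IsCorner o w p m) : w < p := by
  have := h.hn
  rw [Fin.lt_def, h.hp, h.hw]; omega

theorem p_lt_m (h : IsCorner o w p m) : p < m := by
  have := h.hn
  rw [Fin.lt_def, h.hp, h.hm]; omega

theorem o_lt_m (h : IsCorner o w p m) : o < m := h.o_lt_w.trans (h.w_lt_p.trans h.p_lt_m)

theorem o_lt_p (h : IsCorner o w p m) : o < p := h.o_lt_w.trans h.w_lt_p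

theorem w_lt_m (h : IsCorner o w p m) : w < m := h.w_lt_p.trans h.p_lt_m

theorem o_lt (h : IsCorner o w p m) {i : Fin n} (hi : i ≠ o) : o < i := by
  have : i.1 ≠ o.1 := fun h => hi (Fin.ext h)
  have := h.ho
  rw [Fin.lt_def]; omega

theorem lt_m (h : IsCorner o w p m) {i : Fin n} (hi : i ≠ m) : i < m := by
  have : i.1 ≠ m.1 := fun h => hi (Fin.ext h)
  have := h.hm
  rw [Fin.lt_def]; omega

theorem w_lt (h : IsCorner o w p m) {i : Fin n} (hi : i ≠ o) (hi' : i ≠ w) : w < i := by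
  have : i.1 ≠ w.1 := fun h => hi' (Fin.ext h)
  have h1 := h.o_lt hi
  have := h.hw
  rw [Fin.lt_def] at h1 ⊢; omega

theorem lt_p (h : IsCorner o w p m) {i : Fin n} (hi : i ≠ m) (hi' : i ≠ p) : i < p := by
  have : i.1 ≠ p.1 := fun h => hi' (Fin.ext h)
  have h1 := h.lt_m hi
  have := h.hp
  have := h.hm
  rw [Fin.lt_def] at h1 ⊢; omega

theorem not_o (h : IsCorner o w p m) {i j : Fin n} (hi : j < i) : i ≠ o := by
  have := h.ho
  rintro rfl
  rw [Fin.lt_def] at hi; omega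

theorem not_m (h : IsCorner o w p m) {i j : Fin n} (hi : i < j) : i ≠ m := by
  have := h.hm
  rintro rfl
  rw [Fin.lt_def] at hi; omega

end IsCorner

/-! ### Images of x e_{i,j} below the diagonal, and the derivation π of K. -/

section Normalized

variable {K : Type*} [Ring K] {n : ℕ} {J : Ideal K} [J.IsTwoSided]

/-- A Jordan derivation vanishing on the units `e_{i,j}`, `j < i`, up to some entries `(n, 1)`. -/
structure IsNormalized (S : R n J →+ R n J) (o w p m : Fin n) : Prop extends
    IsCorner o w p m where
  two : ∀ x : K, 2 * x = 0 → x = 0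
  jordan : IsJordanDerivation S
  unit : ∀ {i j : Fin n}, j < i → ∀ a b,
    (a = m → b = o → i.1 = j.1 + 1 → i ≠ m → j = o) → img S i j 1 a b = 0

theorem exists_isNormalized (h2 : ∀ x : K, 2 * x = 0 → x = 0) {T : R n J →+ R n J}
    (hT : IsJordanDerivation T) {o w p m : Fin n} (hC : IsCorner o w p m) :
    ∃ Dinn Ddiag : R n J →+ R n J, IsInnerDerivation Dinn ∧ IsDiagonalDerivation Ddiag ∧
      IsNormalized (T - Dinn - Ddiag) o w p m := by
  obtain ⟨Di, Dd, hi, hd, hcol, hrow⟩ := exists_normalization hT hC.ho m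
  have hS := (hT.sub hi.1.isJordanDerivation).sub hd.1.isJordanDerivation
  exact ⟨Di, Dd, hi, hd, ⟨hC, h2, hS, fun hij a b hab =>
    (unitRelations_img hS).eq_zero h2 hC.ho hC.hm hcol hrow hij a b hab⟩⟩

namespace IsNormalized

variable {S : R n J →+ R n J} {o w p m : Fin n}

theorem two' (hS : IsNormalized S o w p m) {x : K} (h : x + x = 0) : x = 0 :=
  hS.two x (by rw [two_mul, h])

theorem unit_of_ne (hS : IsNormalized S o w p m) {i j a b : Fin n} (hij : j < i)
    (h : a ≠ m ∨ b ≠ o) : img S i j 1 a b = 0 :=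
  hS.unit hij a b (by grind)

theorem unit_o (hS : IsNormalized S o w p m) {i : Fin n} (hi : o < i) : img S i o 1 = 0 := by
  ext a b; exact hS.unit hi a b (by grind)

theorem unit_m (hS : IsNormalized S o w p m) {j : Fin n} (hj : j < m) : img S m j 1 = 0 := by
  ext a b; exact hS.unit hj a b (by grind)

/-- The possible corner entries of the unit's image play no role: the relation only reads its row j
and its column i, and j ≠ n, i ≠ 1. -/
theorem lower_rel (hS : IsNormalized S o w p m) {i j k l : Fin n} (hij : j < i) (hkl : l < k)
    (hjk : j ≠ k) (hli : l ≠ i) (x : K) (a b : Fin n) :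
    (if b = l then img S i j x a k else 0) + (if a = k then img S i j x l b else 0) = 0 := by
  have h := img_jordan_zero hS.jordan (not_le_imp hij x) (not_le_imp hkl 1) hjk hli a b
  rw [hS.unit_of_ne hkl (a := j) (b := b) (Or.inl (hS.not_m hij)),
    hS.unit_of_ne hkl (a := a) (b := i) (Or.inr (hS.not_o hij))] at h
  simpa using h

/-- In x e_{i,l} = e_{i,j} e_{j,l} the scalar may sit in either factor. Comparing this lemma with
`lower_right` trades an unknown entry for an entry of a unit's image. -/
theorem lower_left (hS : IsNormalized S o w p m) {i j l : Fin n} (hij : j < i) (hjl : l < j)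
    (x : K) (a b : Fin n) : img S i l x a b =
      (if b = l then img S i j x a j else 0) + (if a = j then img S i j x l b else 0) +
      (if a = i then x * img S j l 1 j b else 0) + (if b = j then img S j l 1 a i * x else 0) := by
  simpa using img_jordan_mul hS.jordan (not_le_imp hij x) (not_le_imp hjl 1)
      (not_le_imp (hjl.trans hij) _) (hjl.trans hij).ne a b

theorem lower_right (hS : IsNormalized S o w p m) {i j l : Fin n} (hij : j < i) (hjl : l < j)
    (x : K) (a b : Fin n) : img S i l x a b =
      (if b = l then img S i j 1 a j * x else 0) + (if a = j then x * img S i j 1 l b else 0) +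
      (if a = i then img S j l x j b else 0) + (if b = j then img S j l x a i else 0) := by
  simpa using img_jordan_mul hS.jordan (not_le_imp hij 1) (not_le_imp hjl x)
      (not_le_imp (hjl.trans hij) _) (hjl.trans hij).ne a b

theorem lower_col (hS : IsNormalized S o w p m) {i j a k : Fin n} (hij : j < i) (x : K)
    (hak : a ≠ k) (hk : k ≠ o) (hkj : k ≠ j) : img S i j x a k = 0 := by
  simpa [hak] using hS.lower_rel hij (hS.o_lt hk) (Ne.symm hkj) (hS.not_o hij).symm x a o

theorem lower_row (hS : IsNormalized S o w p m) {i j l b : Fin n} (hij : j < i) (x : K)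
    (hlb : l ≠ b) (hl : l ≠ m) (hli : l ≠ i) : img S i j x l b = 0 := by
  simpa [hlb.symm] using hS.lower_rel hij (hS.lt_m hl) (hS.not_m hij) hli x m b

/-- Three diagonal entries that are pairwise opposite vanish, because 2 is not a zero divisor. The
proof finds such triples. -/
theorem lower_diag (hS : IsNormalized S o w p m) {i j : Fin n} (hij : j < i) (x : K)
    (k : Fin n) : img S i j x k k = 0 := by
  have hd : ∀ {k l : Fin n}, l < k → j ≠ k → l ≠ i → img S i j x k k + img S i j x l l = 0 := by
    intro k l hkl h1 h2
    have := hS.lower_rel hij hkl h1 h2 x k l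
    simpa using this
  have ho := (hS.not_o hij).symm
  have hm := hS.not_m hij
  have hom := hd hS.o_lt_m hm ho
  have h0 : img S i j x o o = 0 := by
    by_cases hj : j = o
    · obtain ⟨t, hot, htm, hti⟩ : ∃ t, o < t ∧ t < m ∧ t ≠ i := by
        by_cases h : w = i
        · exact ⟨p, hS.o_lt_p, hS.p_lt_m, by rw [← h]; exact hS.w_lt_p.ne'⟩
        · exact ⟨w, hS.o_lt_w, hS.w_lt_m, h⟩
      have h1 := hd hot (by rw [hj]; exact hot.ne) ho
      have h3 := hd htm hm hti
      apply hS.two'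
      grind
    · have h1 := hS.lower_left hij (hS.o_lt hj) x j o
      rw [hS.lower_row (hS.o_lt (hS.not_o hij)) x hj hm hij.ne] at h1
      have h3 := hd (hS.lt_m hm) hm hij.ne
      simp only [if_true, hij.ne, if_false, Ne.symm hj, add_zero] at h1
      apply hS.two'
      grind
  by_cases hkj : k = j
  · by_cases hj : k = o
    · rw [hj, h0]
    · subst hkj
      have h3 := hd (hS.lt_m hm) hm hij.ne
      grind
  · by_cases hk : k = o
    · rw [hk, h0]
    · have := hd (hS.o_lt hk) (Ne.symm hkj) ho
      grind

theorem lower_zero (hS : IsNormalized S o w p m) {i j : Fin n} (hij : j < i) (x : K)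
    {a b : Fin n} (h1 : ¬ (a = i ∧ b = j)) (h2 : ¬ (a = m ∧ b = o)) : img S i j x a b = 0 := by
  by_cases hab : a = b
  · rw [hab]; exact hS.lower_diag hij x b
  by_cases hb : b = o
  · by_cases hai : a = i
    · have hj : j ≠ o := fun h => h1 ⟨hai, hb.trans h.symm⟩
      have hi : i < m := hS.lt_m (fun h => h2 ⟨hai.trans h, hb⟩)
      -- Both expressions compute the entry (n,1) of the image of x e_{n,j}: with x on e_{i,j} it is
      -- the wanted entry, with x on e_{n,i} it is zero.
      have e1 := hS.lower_right hi hij x m o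
      have e2 := hS.lower_left hi hij x m o
      rw [hS.unit_of_ne hij (Or.inl hi.ne)] at e2
      subst hai hb
      simp only [hj.symm, if_false, hi.ne', if_true, Ne.symm hab, add_zero, zero_add,
        mul_zero] at e1 e2
      rw [← e1, e2]
    · by_cases ham : a = m
      · exact absurd ⟨ham, hb⟩ h2
      · exact hS.lower_row hij x hab ham hai
  · by_cases hbj : b = j
    · by_cases ham : a = m
      · have hi : i < m := hS.lt_m (fun h => h1 ⟨ham.trans h.symm, hbj⟩)
        have hj : o < j := by rw [← hbj]; exact hS.o_lt hb
        have e1 := hS.lower_right hij hj x m o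
        have e2 := hS.lower_left hij hj x m o
        rw [hS.unit_of_ne hij (Or.inr hj.ne')] at e1
        have := hS.not_m hij
        subst hbj ham
        simp only [if_true, this.symm, hi.ne', hj.ne, if_false, zero_mul, add_zero] at e1 e2
        rw [← e2, e1]
      · by_cases hai : a = i
        · exact absurd ⟨hai, hbj⟩ h1
        · exact hS.lower_row hij x hab ham hai
    · exact hS.lower_col hij x hab hb hbj

theorem lower_first (hS : IsNormalized S o w p m) {i : Fin n} (hi : o < i) (x : K) :
    img S i o x i o = img S w o x w o := by
  by_cases hw : i = w
  · rw [hw]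
  have hwi := hS.w_lt hi.ne' hw
  have e := hS.lower_right hwi hS.o_lt_w x i o
  rw [hS.unit_of_ne hwi (Or.inr hS.o_lt_w.ne')] at e
  simpa [hwi.ne', hS.o_lt_w.ne] using e

theorem lower_eq (hS : IsNormalized S o w p m) {i j : Fin n} (hij : j < i) (x : K) :
    img S i j x i j = img S w o x w o := by
  by_cases hj : j = o
  · rw [hj]; exact hS.lower_first (hj ▸ hij) x
  have hoj := hS.o_lt hj
  rw [← hS.lower_first (hoj.trans hij)]
  have e := hS.lower_left hij hoj x i o
  rw [hS.unit_o hoj] at e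
  simpa [hij.ne', hoj.ne] using e.symm

/-- A middle index t = j + 1 exists when i > j + 1, and factoring x e_{i,j} through it leaves
nothing at (n,1). -/
theorem lower_corner (hS : IsNormalized S o w p m) {i j : Fin n} (hij : j < i) (x : K)
    (h : i.1 ≠ j.1 + 1) (h' : ¬ (i = m ∧ j = o)) : img S i j x m o = 0 := by
  rw [Fin.lt_def] at hij
  obtain ⟨t, ht⟩ : ∃ t : Fin n, t.1 = j.1 + 1 := ⟨⟨j.1 + 1, by omega⟩, rfl⟩
  have hit : t < i := by rw [Fin.lt_def]; omega
  have hjt : j < t := by rw [Fin.lt_def]; omega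
  have e := hS.lower_left hit hjt x m o
  have htm := hS.not_m hit
  have hto := hS.not_o hjt
  simp only [htm.symm, hto.symm, if_false, add_zero] at e
  rw [e, hS.unit_of_ne hjt (Or.inl htm)]
  by_cases hj : j = o
  · rw [hS.lower_zero hit x (a := m) (b := t) (fun h => h' ⟨h.1.symm, hj⟩) (fun h => hto h.2)]
    simp
  · simp [Ne.symm hj]

/-- The derivation of `K` read off from the entries of a normalised Jordan derivation. -/
noncomputable def ringDer (hS : IsNormalized S o w p m) : K →+ K where
  toFun x := img S w o x w o
  map_zero' := by
    have h := img_add S (not_le_imp (J := J) hS.o_lt_w 0) (not_le_imp hS.o_lt_w 0)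
    rw [add_zero] at h
    rw [left_eq_add.mp h]; rfl
  map_add' x y := by
    rw [img_add S (not_le_imp (J := J) hS.o_lt_w x) (not_le_imp hS.o_lt_w y)]; rfl

theorem img_lower (hS : IsNormalized S o w p m) {i j : Fin n} (hij : j < i) (x : K) :
    img S i j x = Matrix.single i j (hS.ringDer x) +
      Matrix.single m o (if i.1 = j.1 + 1 then img S i j x m o else 0) := by
  have hmo : m.1 ≠ o.1 + 1 := by
    rw [hS.hm, hS.ho]; have := hS.hn; omega
  ext a b
  rw [Matrix.add_apply, Matrix.single_apply, Matrix.single_apply]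
  show _ = (if i = a ∧ j = b then img S w o x w o else 0) + _
  rw [← hS.lower_eq hij x]
  by_cases h1 : i = a ∧ j = b
  · obtain ⟨rfl, rfl⟩ := h1
    by_cases h2 : m = i ∧ o = j
    · obtain ⟨rfl, rfl⟩ := h2
      simp [hmo]
    · simp [h2]
  · by_cases h2 : m = a ∧ o = b
    · obtain ⟨rfl, rfl⟩ := h2
      by_cases h3 : i.1 = j.1 + 1
      · simp [h1, h3]
      · simp [h1, h3, hS.lower_corner hij x h3 h1]
    · rw [hS.lower_zero hij x (by grind) (by grind)]
      simp [h1, h2]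

theorem isDerivation_ringDer (hS : IsNormalized S o w p m) : IsDerivation hS.ringDer := by
  intro x z
  obtain ⟨t, ht⟩ : ∃ t : Fin n, t.1 = 2 := ⟨⟨2, by have := hS.hn; omega⟩, rfl⟩
  have htw : w < t := by rw [Fin.lt_def, hS.hw]; omega
  have e := img_jordan_mul hS.jordan (not_le_imp (J := J) htw x) (not_le_imp hS.o_lt_w z)
    (not_le_imp (hS.o_lt_w.trans htw) _) (hS.o_lt_w.trans htw).ne t o
  rw [hS.lower_eq (hS.o_lt_w.trans htw), hS.lower_eq htw] at e
  show img S w o (x * z) w o = img S w o x w o * z + x * img S w o z w o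
  simpa [htw.ne', hS.o_lt_w.ne] using e

end IsNormalized

end Normalized

/-! ### Images of y e_{1,n}, and the annihilator property of the corner entries. -/

section Top

variable {K : Type*} [Ring K] {n : ℕ} {J : Ideal K} [J.IsTwoSided]

namespace IsNormalized

variable {S : R n J →+ R n J} {o w p m : Fin n}

/-- The corner entries that survive for units annihilate J, so they disappear from every triple
identity with y e_{1,n}. -/
theorem unit_corner_mul (hS : IsNormalized S o w p m) {i j : Fin n} (hij : j < i) {y : K}
    (hy : y ∈ J) : y * img S i j 1 m o = 0 ∧ img S i j 1 m o * y = 0 := by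
  by_cases hj : j = o
  · subst hj; simp [hS.unit_o hij]
  by_cases hi : i = m
  · subst hi; simp [hS.unit_m hij]
  have h := img_jordan_zero hS.jordan (fun _ : o ≤ m => hy) (not_le_imp hij 1) (Ne.symm hi) hj
  have h1 := h o o
  have h3 := h m m
  have hom := hS.o_lt_m.ne
  constructor
  · simpa [Ne.symm hj, (hS.not_o hij).symm, hom] using h1
  · simpa [Ne.symm hi, (hS.not_m hij).symm, hom.symm] using h3

theorem unit_mul_single (hS : IsNormalized S o w p m) {i j : Fin n} (hij : j < i) {y : K}
    (hy : y ∈ J) : img S i j 1 * Matrix.single o m y = 0 ∧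
      Matrix.single o m y * img S i j 1 = 0 := by
  have hc := hS.unit_corner_mul hij hy
  constructor
  · ext a b
    rw [mul_single_apply']
    by_cases ha : a = m
    · subst ha; simp [hc.2]
    · simp [hS.unit_of_ne hij (Or.inl ha)]
  · ext a b
    rw [single_mul_apply']
    by_cases hb : b = o
    · subst hb; simp [hc.1]
    · simp [hS.unit_of_ne hij (Or.inr hb)]

/-- The hypotheses make e_{i,j} (y e_{1,n}) e_{k,l} zero in both orders. The outer terms of the
triple identity vanish as well, and the middle one is the entry (j,k). -/
theorem top_aux (hS : IsNormalized S o w p m) {i j k l : Fin n} (hij : j < i) (hkl : l < k)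
    (h1 : j ≠ o ∨ k ≠ m) (h2 : l ≠ o ∨ i ≠ m) {y : K} (hy : y ∈ J) : img S o m y j k = 0 := by
  have h := img_triple hS.two hS.jordan (not_le_imp hij 1) (fun _ : o ≤ m => hy)
    (not_le_imp hkl 1)
  have e : elem i j 1 (not_le_imp (J := J) hij 1) * elem o m y (fun _ => hy) *
      elem k l 1 (not_le_imp (J := J) hkl 1) + elem k l 1 (not_le_imp (J := J) hkl 1) *
      elem o m y (fun _ => hy) * elem i j 1 (not_le_imp (J := J) hij 1) = 0 := by
    apply Subtype.ext
    have e1 : Matrix.single i j (1 : K) * Matrix.single o m y * Matrix.single k l 1 = 0 := by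
      rcases h1 with h | h
      · simp [Matrix.single_mul_single_of_ne, h]
      · rw [mul_assoc]; simp [Matrix.single_mul_single_of_ne, h.symm]
    have e2 : Matrix.single k l (1 : K) * Matrix.single o m y * Matrix.single i j 1 = 0 := by
      rcases h2 with h | h
      · simp [Matrix.single_mul_single_of_ne, h]
      · rw [mul_assoc]; simp [Matrix.single_mul_single_of_ne, h.symm]
    show Matrix.single i j (1 : K) * Matrix.single o m y * Matrix.single k l 1 +
      Matrix.single k l (1 : K) * Matrix.single o m y * Matrix.single i j 1 = 0
    rw [e1, e2, add_zero]
  rw [e, map_zero, (hS.unit_mul_single hij hy).1, (hS.unit_mul_single hkl hy).1,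
    mul_assoc (Matrix.single i j (1 : K)), mul_assoc (Matrix.single k l (1 : K)),
    (hS.unit_mul_single hij hy).2, (hS.unit_mul_single hkl hy).2] at h
  have h' := congrFun (congrFun h i) l
  simp only [zero_mul, mul_zero, one_mul, mul_one, zero_add, add_zero, Matrix.add_apply,
    Matrix.single_apply_same, Matrix.single_apply] at h'
  have h'' : (0 : K) = img S o m y j k + if k = i ∧ j = l then img S o m y l i else 0 := h'
  -- If both units coincide, the wanted entry occurs twice.
  by_cases hc : k = i ∧ j = l
  · obtain ⟨rfl, rfl⟩ := hc
    simp only [and_self, if_true] at h''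
    exact hS.two' h''.symm
  · simpa [hc, eq_comm (a := (0 : K))] using h''

theorem top_inner (hS : IsNormalized S o w p m) {j k : Fin n} (hj : j ≠ m) (hk : k ≠ o)
    (h1 : ¬ (j = o ∧ k = m)) (h2 : ¬ (j = p ∧ k = w)) {y : K} (hy : y ∈ J) :
    img S o m y j k = 0 := by
  by_cases hkw : k = w
  · have hjp : j ≠ p := fun h => h2 ⟨h, hkw⟩
    exact hS.top_aux (hS.lt_p hj hjp) (hS.o_lt hk) (by grind) (Or.inr hS.p_lt_m.ne) hy
  · exact hS.top_aux (hS.lt_m hj) (hS.w_lt hk hkw) (by grind) (Or.inl hS.o_lt_w.ne') hy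

theorem top_eq (hS : IsNormalized S o w p m) {y : K} (hy : y ∈ J) {a b : Fin n}
    (h1 : ¬ (a = o ∧ b = m)) (h2 : ¬ (a = o ∧ b = o)) (h3 : ¬ (a = m ∧ b = m))
    (h4 : ¬ (a = m ∧ b = o)) (h5 : ¬ (a = p ∧ b = o)) (h6 : ¬ (a = p ∧ b = w))
    (h7 : ¬ (a = m ∧ b = w)) : img S o m y a b = 0 := by
  by_cases ha : a = m
  · have hbo : b ≠ o := fun h => h4 ⟨ha, h⟩
    have hbm : b ≠ m := fun h => h3 ⟨ha, h⟩
    have hwb := hS.w_lt hbo (fun h => h7 ⟨ha, h⟩)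
    have h := img_jordan_zero hS.jordan (fun _ : o ≤ m => hy) (not_le_imp hwb 1) hbm.symm
      hS.o_lt_w.ne' m w
    simpa [ha, hS.o_lt_m.ne', hbm.symm, hS.w_lt_m.ne] using h
  · by_cases hb : b = o
    · have hao : a ≠ o := fun h => h2 ⟨h, hb⟩
      have hap := hS.lt_p ha (fun h => h5 ⟨h, hb⟩)
      have h := img_jordan_zero hS.jordan (fun _ : o ≤ m => hy) (not_le_imp hap 1) hS.p_lt_m.ne'
        hao p o
      simpa [hb, hS.o_lt_m.ne, hao.symm, hS.o_lt_p.ne'] using h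
    · exact hS.top_inner ha hb h1 h6 hy

theorem img_sandwich (hS : IsNormalized S o w p m) {i l : Fin n} (hoi : o < i) (hlm : l < m)
    (him : ¬ (i = m ∧ l = o)) {y : K} (hy : y ∈ J) :
    img S i l y = Matrix.single i l (img S o m y o m) + Matrix.single m o (img S o m y l i) := by
  rw [JordanDer.img_sandwich hS.two hS.jordan hoi hlm him hy, hS.unit_o hoi, hS.unit_m hlm]
  simp

/-- On J the map π can be read at a position above the diagonal, which gives π(J) ⊆ J. -/
theorem ringDer_eq (hS : IsNormalized S o w p m) {y : K} (hy : y ∈ J) :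
    hS.ringDer y = img S o m y o m := by
  show img S w o y w o = _
  rw [hS.img_sandwich hS.o_lt_w hS.o_lt_m (fun h => hS.w_lt_m.ne h.1) hy]
  simp [hS.w_lt_m.ne']

theorem ringDer_mem (hS : IsNormalized S o w p m) {y : K} (hy : y ∈ J) : hS.ringDer y ∈ J := by
  rw [hS.ringDer_eq hy]; exact img_mem _ _ _ _ hS.o_lt_m.le

/-- This is ς_j(J) = 0. For y in J, y e_{i,j} = e_{i,1} (y e_{1,n}) e_{n,j}, so the corner entry is
the entry (j,i) of the image of y e_{1,n}; the exception (n-1,2) in `top_inner` cannot occur as j <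
i. -/
theorem lower_corner_ideal (hS : IsNormalized S o w p m) {i j : Fin n} (hij : j < i) {y : K}
    (hy : y ∈ J) (him : ¬ (i = m ∧ j = o)) : img S i j y m o = 0 := by
  have hi := hS.not_o hij
  have hj := hS.not_m hij
  rw [hS.img_sandwich (hS.o_lt hi) (hS.lt_m hj) him hy]
  rw [hS.top_inner hj hi (fun h => him ⟨h.2, h.1⟩)
    (fun h => absurd (h.1 ▸ h.2 ▸ hij) (not_lt.mpr hS.w_lt_p.le)) hy]
  rw [Matrix.add_apply, Matrix.single_apply_of_ne (h := fun h => him h)]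
  simp

/-- Away from e_{2,1} and e_{n,n-1} the element x e_{i,j} has zero products with y e_{1,n}, which
gives both equations. In these two cases one equation compares the two positions of x in a product
with y e_{1,n}; the other uses a triple product that vanishes in both orders. -/
theorem lower_corner_ann (hS : IsNormalized S o w p m) {i j : Fin n} (hij : j < i)
    (him : ¬ (i = m ∧ j = o)) (x : K) {y : K} (hy : y ∈ J) :
    img S i j x m o * y = 0 ∧ y * img S i j x m o = 0 := by
  by_cases hadj : i.1 = j.1 + 1
  swap
  · rw [hS.lower_corner hij x hadj him]; simp
  by_cases hj : j = o
  · subst hj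
    have hiw : i = w := Fin.ext (by rw [hadj, hS.ho, hS.hw])
    subst hiw
    have hjm := hS.o_lt_m.ne
    have him' := hS.w_lt_m.ne
    have hij' := hij.ne
    constructor
    · have e1 := img_jordan_mul hS.jordan (not_le_imp hij x) (fun _ : j ≤ m => hy)
        (fun _ => J.mul_mem_left x hy) him'.symm m m
      have e2 := img_jordan_mul hS.jordan (not_le_imp hij 1) (fun _ : j ≤ m => J.mul_mem_left x hy)
        (fun _ => by simpa using J.mul_mem_left x hy) him'.symm m m
      rw [hS.unit_o hij] at e2
      simp only [one_mul, if_true, him'.symm, hjm.symm, if_false, add_zero, Matrix.zero_apply,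
        zero_mul] at e1 e2
      rw [← e1, e2]
    · have h := img_triple hS.two hS.jordan (not_le_imp hij x) (fun _ : j ≤ m => hy)
        (not_le_imp hij 1)
      have e : elem i j x (not_le_imp (J := J) hij x) * elem j m y (fun _ => hy) *
          elem i j 1 (not_le_imp (J := J) hij 1) + elem i j 1 (not_le_imp (J := J) hij 1) *
          elem j m y (fun _ => hy) * elem i j x (not_le_imp (J := J) hij x) = 0 := by
        apply Subtype.ext
        simp [Matrix.single_mul_single_of_ne, him'.symm]
      rw [e, map_zero, hS.unit_o hij, hS.top_inner hjm hij.ne' (fun h => him' h.2)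
        (fun h => hS.o_lt_p.ne h.1) hy] at h
      have h' := congrFun (congrFun h i) j
      simpa [mul_assoc, Matrix.single_mul_single_of_ne, him'.symm, single_mul_apply',
        eq_comm (a := (0 : K))] using h'
  by_cases hi : i = m
  · subst hi
    have hjp : j = p := Fin.ext (by
      have := hS.hp; have := hS.hm; have := hS.hn; omega)
    subst hjp
    have hij' := hij.ne
    have hoj := Ne.symm hj
    have hoi := hS.o_lt_m.ne
    constructor
    · have h := img_triple hS.two hS.jordan (not_le_imp hij x) (fun _ : o ≤ i => hy)
        (not_le_imp hij 1)
      have e : elem i j x (not_le_imp (J := J) hij x) * elem o i y (fun _ => hy) *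
          elem i j 1 (not_le_imp (J := J) hij 1) + elem i j 1 (not_le_imp (J := J) hij 1) *
          elem o i y (fun _ => hy) * elem i j x (not_le_imp (J := J) hij x) = 0 := by
        apply Subtype.ext
        simp [Matrix.single_mul_single_of_ne, hj]
      rw [e, map_zero, hS.unit_m hij, hS.top_inner hij' hoi.symm (fun h => hj h.1)
        (fun h => hS.w_lt_m.ne h.2.symm) hy] at h
      have h' := congrFun (congrFun h i) j
      simpa [mul_assoc, Matrix.single_mul_single_of_ne, hj, mul_single_apply',
        eq_comm (a := (0 : K))] using h'
    · have e1 := img_jordan_mul hS.jordan (fun _ : o ≤ i => hy) (not_le_imp hij x)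
        (fun _ => J.mul_mem_right x hy) hj o o
      have e2 := img_jordan_mul hS.jordan (fun _ : o ≤ i => J.mul_mem_right x hy)
        (not_le_imp hij 1) (fun _ => by simpa using J.mul_mem_right x hy) hj o o
      rw [hS.unit_m hij] at e2
      simp only [mul_one, if_true, hoj, hoi, if_false, add_zero, zero_add, Matrix.zero_apply,
        mul_zero] at e1 e2
      rw [← e1, e2]
  have h := img_jordan_zero hS.jordan (fun _ : o ≤ m => hy) (not_le_imp hij x) (Ne.symm hi) hj
  have h1 := h o o
  have h3 := h m m
  have hom := hS.o_lt_m.ne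
  constructor
  · simpa [Ne.symm hi, (hS.not_m hij).symm, hom.symm] using h3
  · simpa [Ne.symm hj, (hS.not_o hij).symm, hom] using h1

end IsNormalized

end Top

/-! ### Removing the ring and the annihilator derivation. -/

section RingAnnihilator

variable {K : Type*} [Ring K] {n : ℕ} {J : Ideal K} [J.IsTwoSided]

/-- Entrywise application of an additive map of `K` preserving `J`. -/
def entrywise (n : ℕ) (π : K →+ K) (hπ : ∀ y ∈ J, π y ∈ J) : R n J →+ R n J where
  toFun X := ⟨X.1.map π, fun i j h => hπ _ (X.2 i j h)⟩
  map_zero' := Subtype.ext (by ext; simp)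
  map_add' X Y := Subtype.ext (by ext; simp)

theorem isRingInducedDerivation_entrywise {π : K →+ K} (hd : IsDerivation π)
    (hπ : ∀ y ∈ J, π y ∈ J) : IsRingInducedDerivation (entrywise n π hπ) := by
  refine ⟨fun X Y => Subtype.ext ?_, π, hd, hπ, fun X => rfl⟩
  ext i j
  show π ((X.1 * Y.1) i j) = (X.1.map π * Y.1 + X.1 * Y.1.map π) i j
  simp only [Matrix.mul_apply, Matrix.add_apply, map_sum, Matrix.map_apply,
    ← Finset.sum_add_distrib]
  exact Finset.sum_congr rfl fun k _ => hd _ _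

theorem single_mem {i j : Fin n} (h : j < i) (x : K) : Matrix.single i j x ∈ R n J :=
  (elem i j x (not_le_imp h x)).2

/-- The map `X ↦ (∑ i, s i (X_{i+1,i})) e_{n,1}`. -/
def cornerSum (hn : 4 ≤ n) (s : Fin (n - 1) → (K →+ annK J)) : R n J →+ R n J where
  toFun X := ⟨Matrix.single (ixLast hn) (ixOne hn)
    (∑ i : Fin (n - 1), (s i (X.1 ⟨i.1 + 1, by omega⟩ ⟨i.1, by omega⟩) : K)),
    single_mem (by rw [Fin.lt_def]; simp only [ixLast, ixOne]; omega) _⟩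
  map_zero' := Subtype.ext (by simp)
  map_add' X Y := Subtype.ext (by simp [Finset.sum_add_distrib, Matrix.single_add])

/-- Products have entries in J even on the first subdiagonal, so maps ς_i with ς_i(J) = 0 do not see
them. -/
theorem mul_mem_of_adj (X Y : R n J) {i j : Fin n} (h : i.1 ≤ j.1 + 1) :
    (X.1 * Y.1) i j ∈ J := by
  rw [Matrix.mul_apply]
  refine J.sum_mem fun k _ => ?_
  rcases le_or_gt i k with hk | hk
  · exact J.mul_mem_right _ (X.2 i k hk)
  · refine J.mul_mem_left _ (Y.2 k j ?_)
    rw [Fin.lt_def] at hk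
    rw [Fin.le_def]; omega

theorem isAnnihilatorDerivation_cornerSum (hn : 4 ≤ n) {s : Fin (n - 1) → (K →+ annK J)}
    (hs : ∀ i, ∀ y ∈ J, s i y = 0) : IsAnnihilatorDerivation hn (cornerSum hn s) := by
  -- Here ς_n is zero; its role is taken over by the map c of the almost annihilator derivation.
  refine ⟨fun X Y => Subtype.ext ?_, 0, s, fun _ _ => rfl, hs, fun X => ?_⟩
  · have hc : ∀ X : R n J,
        (∑ i : Fin (n - 1), (s i (X.1 ⟨i.1 + 1, by omega⟩ ⟨i.1, by omega⟩) : K)) ∈ annK J :=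
      fun X => (annK J).sum_mem fun i _ => (s i _).2
    show Matrix.single (ixLast hn) (ixOne hn) _ =
      Matrix.single (ixLast hn) (ixOne hn) _ * Y.1 + X.1 * Matrix.single (ixLast hn) (ixOne hn) _
    ext a b
    rw [Matrix.add_apply, single_mul_apply', mul_single_apply',
      (hc X _ (Y.2 (ixOne hn) b (ixOne_le hn b))).1,
      (hc Y _ (X.2 a (ixLast hn) (le_ixLast hn a))).2]
    have : (∑ i : Fin (n - 1),
        (s i ((X * Y : R n J).1 ⟨i.1 + 1, by omega⟩ ⟨i.1, by omega⟩) : K)) = 0 := by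
      refine Finset.sum_eq_zero fun i _ => ?_
      have hm : (X * Y : R n J).1 ⟨i.1 + 1, by omega⟩ ⟨i.1, by omega⟩ ∈ J :=
        mul_mem_of_adj X Y (by simp)
      rw [hs i _ hm]; rfl
    rw [this]
    simp
  · show Matrix.single (ixLast hn) (ixOne hn) _ = Matrix.single (ixLast hn) (ixOne hn) _
    simp

theorem isCorner_ix (hn : 4 ≤ n) : IsCorner (ixOne hn) (ixTwo hn) (ixPred hn) (ixLast hn) :=
  ⟨hn, rfl, rfl, rfl, rfl⟩

/-- A Jordan derivation vanishing on all elementary matrices below the diagonal, and taking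
`J e_{1,n}` to matrices supported on six positions. -/
structure IsReduced (S : R n J →+ R n J) (o w p m : Fin n) : Prop extends
    IsCorner o w p m where
  two : ∀ x : K, 2 * x = 0 → x = 0
  jordan : IsJordanDerivation S
  low : ∀ {i j : Fin n}, j < i → ∀ x, img S i j x = 0
  top : ∀ {y : K}, y ∈ J → ∀ {a b : Fin n}, ¬ (a = o ∧ b = o) → ¬ (a = m ∧ b = m) →
    ¬ (a = m ∧ b = o) → ¬ (a = p ∧ b = o) → ¬ (a = p ∧ b = w) → ¬ (a = m ∧ b = w) →
    img S o m y a b = 0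

theorem IsNormalized.exists_isReduced (hn : 4 ≤ n) {S : R n J →+ R n J}
    (hS : IsNormalized S (ixOne hn) (ixTwo hn) (ixPred hn) (ixLast hn)) :
    ∃ Dring Dann : R n J →+ R n J, IsRingInducedDerivation Dring ∧
      IsAnnihilatorDerivation hn Dann ∧
      IsReduced (S - Dring - Dann) (ixOne hn) (ixTwo hn) (ixPred hn) (ixLast hn) := by
  have hlt : ∀ t : Fin (n - 1), (⟨t.1, by omega⟩ : Fin n) < ⟨t.1 + 1, by omega⟩ := fun t => by
    rw [Fin.lt_def]; exact Nat.lt_succ_self _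
  have hne : ∀ t : Fin (n - 1),
      ¬ ((⟨t.1 + 1, by omega⟩ : Fin n) = ixLast hn ∧ (⟨t.1, by omega⟩ : Fin n) = ixOne hn) := by
    rintro t ⟨h1, h3⟩
    simp only [ixLast, ixOne, Fin.mk.injEq] at h1 h3
    omega
  let s : Fin (n - 1) → (K →+ annK J) := fun t => AddMonoidHom.mk'
    (fun x => ⟨img S ⟨t.1 + 1, by omega⟩ ⟨t.1, by omega⟩ x (ixLast hn) (ixOne hn),
      fun y hy => hS.lower_corner_ann (hlt t) (hne t) x hy⟩)
    (fun x y => Subtype.ext (congrFun (congrFun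
      (img_add S (not_le_imp (hlt t) x) (not_le_imp (hlt t) y)) (ixLast hn)) (ixOne hn)))
  have hs : ∀ t, ∀ y ∈ J, s t y = 0 := fun t y hy =>
    Subtype.ext (hS.lower_corner_ideal (hlt t) hy (hne t))
  have hring := isRingInducedDerivation_entrywise (n := n) hS.isDerivation_ringDer
    fun y hy => hS.ringDer_mem hy
  have hann := isAnnihilatorDerivation_cornerSum hn hs
  have hsum : ∀ (i j : Fin n) (x : K), (∑ t : Fin (n - 1),
      (s t (Matrix.single i j x ⟨t.1 + 1, by omega⟩ ⟨t.1, by omega⟩) : K)) =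
      if i.1 = j.1 + 1 then img S i j x (ixLast hn) (ixOne hn) else 0 := by
    intro i j x
    split_ifs with h
    · rw [Finset.sum_eq_single (⟨j.1, by omega⟩ : Fin (n - 1))]
      · have e1 : (⟨j.1 + 1, by omega⟩ : Fin n) = i := Fin.ext h.symm
        show img S ⟨j.1 + 1, _⟩ ⟨j.1, _⟩ (Matrix.single i j x ⟨j.1 + 1, _⟩ ⟨j.1, _⟩) _ _ = _
        simp only [e1, Fin.eta, Matrix.single_apply_same]
      · intro t _ ht
        rw [Matrix.single_apply_of_ne]
        · simp
        · rintro ⟨_, h3⟩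
          exact ht (Fin.ext (congrArg Fin.val h3).symm)
      · simp
    · refine Finset.sum_eq_zero fun t _ => ?_
      rw [Matrix.single_apply_of_ne]
      · simp
      · rintro ⟨h1, h3⟩
        apply h; rw [h1, h3]
  have himg_ann : ∀ {i j : Fin n} {x : K} (h : i ≤ j → x ∈ J), img (cornerSum hn s) i j x =
      Matrix.single (ixLast hn) (ixOne hn)
        (if i.1 = j.1 + 1 then img S i j x (ixLast hn) (ixOne hn) else 0) := by
    intro i j x h
    rw [img_eq _ h, ← hsum]
    rfl
  have himg_ring : ∀ {i j : Fin n} {x : K} (h : i ≤ j → x ∈ J),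
      img (entrywise n hS.ringDer fun y hy => hS.ringDer_mem hy) i j x =
      Matrix.single i j (hS.ringDer x) := by
    intro i j x h
    rw [img_eq _ h]
    exact Matrix.map_single i j x hS.ringDer
  refine ⟨_, _, hring, hann, hS.toIsCorner, hS.two,
    (hS.jordan.sub hring.1.isJordanDerivation).sub hann.1.isJordanDerivation, ?_, ?_⟩
  · intro i j hij x
    rw [img_sub_map, img_sub_map, himg_ann (not_le_imp hij x), himg_ring (not_le_imp hij x),
      sub_sub, sub_eq_zero]
    exact hS.img_lower hij x
  · intro y hy a b h1 h3 h4 h5 h6 h7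
    have hadj : (ixOne hn).1 ≠ (ixLast hn).1 + 1 := by simp [ixOne, ixLast]
    rw [img_sub_map, img_sub_map, himg_ann (fun _ => hy), himg_ring (fun _ => hy), if_neg hadj,
      hS.ringDer_eq hy]
    simp only [Matrix.sub_apply, Matrix.single_zero, Matrix.zero_apply, sub_zero]
    by_cases hc : a = ixOne hn ∧ b = ixLast hn
    · obtain ⟨rfl, rfl⟩ := hc
      simp
    · rw [hS.top_eq hy hc h1 h3 h4 h5 h6 h7, Matrix.single_apply_of_ne
        (h := fun h => hc ⟨h.1.symm, h.2.symm⟩), sub_zero]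

end RingAnnihilator

/-! ### Identities for the six remaining entries a, b, c, α, β, γ. -/

section Relations

variable {K : Type*} [Ring K] {n : ℕ} {J : Ideal K} [J.IsTwoSided]

namespace IsReduced

variable {S : R n J →+ R n J} {o w p m : Fin n}

/-- From xy e_{2,n} = (x e_{2,1})(y e_{1,n}). Comparison with the case x = 1 applied to xy yields
the rules for a(xy), β(xy) and γ(xy); `img_first_pred` is the mirror image, for b, α and β. -/
theorem img_second_last (hS : IsReduced S o w p m) (x : K) {y : K} (hy : y ∈ J) (a b : Fin n) :
    img S w m (x * y) a b = (if a = w then x * img S o m y o b else 0) +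
      (if b = o then img S o m y a w * x else 0) := by
  have h := img_jordan_mul hS.jordan (not_le_imp hS.o_lt_w x) (fun _ : o ≤ m => hy)
    (fun _ => J.mul_mem_left x hy) hS.w_lt_m.ne' a b
  rw [hS.low hS.o_lt_w] at h
  simpa using h

theorem img_second_last' (hS : IsReduced S o w p m) {y : K} (hy : y ∈ J) (a b : Fin n) :
    img S w m y a b = (if a = w then img S o m y o b else 0) +
      (if b = o then img S o m y a w else 0) := by
  simpa using hS.img_second_last 1 hy a b

theorem img_first_pred (hS : IsReduced S o w p m) (x : K) {y : K} (hy : y ∈ J) (a b : Fin n) :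
    img S o p (y * x) a b = (if b = p then img S o m y a m * x else 0) +
      (if a = m then x * img S o m y p b else 0) := by
  have h := img_jordan_mul hS.jordan (fun _ : o ≤ m => hy) (not_le_imp hS.p_lt_m x)
    (fun _ => J.mul_mem_right x hy) hS.o_lt_p.ne' a b
  rw [hS.low hS.p_lt_m] at h
  simpa using h

theorem img_first_pred' (hS : IsReduced S o w p m) {y : K} (hy : y ∈ J) (a b : Fin n) :
    img S o p y a b = (if b = p then img S o m y a m else 0) +
      (if a = m then img S o m y p b else 0) := by
  simpa using hS.img_first_pred 1 hy a b

theorem top_w (hS : IsReduced S o w p m) {y : K} (hy : y ∈ J) (b : Fin n) :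
    img S o m y w b = 0 := by
  have := hS.o_lt_w.ne; have := hS.w_lt_p.ne; have := hS.w_lt_m.ne
  apply hS.top hy <;> grind

theorem top_p (hS : IsReduced S o w p m) {y : K} (hy : y ∈ J) (a : Fin n) :
    img S o m y a p = 0 := by
  have := hS.o_lt_p.ne; have := hS.w_lt_p.ne; have := hS.p_lt_m.ne
  apply hS.top hy <;> grind

theorem img_diag (hS : IsReduced S o w p m) {i : Fin n} (hi : o < i) (hi' : i < m) {z : K}
    (hz : z ∈ J) : img S i i z = Matrix.single m o (img S o m z i i) := by
  have hom := hS.o_lt_m.ne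
  have hop := hS.o_lt_p.ne
  rw [img_sandwich hS.two hS.jordan hi hi' (fun h => hi'.ne h.1) hz, hS.low hi, hS.low hi',
    hS.top hz (a := o) (b := m)]
  · simp
  all_goals grind

theorem a_mul (hS : IsReduced S o w p m) (x : K) {y : K} (hy : y ∈ J) :
    img S o m (x * y) o o = x * img S o m y o o := by
  have h1 := hS.img_second_last x hy w o
  have h3 := hS.img_second_last' (J.mul_mem_left x hy) w o
  simp only [if_true, hS.top_w hy, hS.top_w (J.mul_mem_left x hy), zero_mul, add_zero] at h1 h3
  rw [← h1, h3]

theorem mul_second (hS : IsReduced S o w p m) (x : K) {y : K} (hy : y ∈ J) {a : Fin n}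
    (ha : a ≠ w) : img S o m (x * y) a w = img S o m y a w * x := by
  have h1 := hS.img_second_last x hy a o
  have h3 := hS.img_second_last' (J.mul_mem_left x hy) a o
  simp only [if_true, ha, if_false, zero_add] at h1 h3
  rw [← h1, h3]

theorem b_mul (hS : IsReduced S o w p m) (x : K) {y : K} (hy : y ∈ J) :
    img S o m (y * x) m m = img S o m y m m * x := by
  have h1 := hS.img_first_pred x hy m p
  have h3 := hS.img_first_pred' (J.mul_mem_right x hy) m p
  simp only [if_true, hS.top_p hy, hS.top_p (J.mul_mem_right x hy), mul_zero, add_zero] at h1 h3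
  rw [← h1, h3]

theorem mul_pred (hS : IsReduced S o w p m) (x : K) {y : K} (hy : y ∈ J) {b : Fin n}
    (hb : b ≠ p) : img S o m (y * x) p b = x * img S o m y p b := by
  have h1 := hS.img_first_pred x hy m b
  have h3 := hS.img_first_pred' (J.mul_mem_right x hy) m b
  simp only [if_true, hb, if_false, zero_add] at h1 h3
  rw [← h1, h3]

/-- Source of zc(y) = 0, a(z)y + zb(y) = 0 and yγ(z) = 0; `first_pred_rel` gives c(y)z = 0 and α(z)y
= 0. -/
theorem second_last_rel (hS : IsReduced S o w p m) {y z : K} (hy : y ∈ J) (hz : z ∈ J)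
    (a b : Fin n) :
    (if b = m then img S o m y a w * z else 0) + (if a = w then z * img S o m y m b else 0) +
      (if a = o then y * img S w m z m b else 0) + (if b = m then img S w m z a o * y else 0)
      = 0 :=
  img_jordan_zero hS.jordan (fun _ : o ≤ m => hy) (fun _ : w ≤ m => hz) hS.w_lt_m.ne'
    hS.o_lt_m.ne' a b

theorem first_pred_rel (hS : IsReduced S o w p m) {y z : K} (hy : y ∈ J) (hz : z ∈ J)
    (a b : Fin n) :
    (if b = p then img S o m y a o * z else 0) + (if a = o then z * img S o m y p b else 0) +
      (if a = o then y * img S o p z m b else 0) + (if b = m then img S o p z a o * y else 0)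
      = 0 :=
  img_jordan_zero hS.jordan (fun _ : o ≤ m => hy) (fun _ : o ≤ p => hz) hS.o_lt_m.ne'
    hS.o_lt_p.ne' a b

theorem mul_c (hS : IsReduced S o w p m) {y z : K} (hy : y ∈ J) (hz : z ∈ J) :
    z * img S o m y m o = 0 := by
  simpa [hS.o_lt_m.ne, hS.o_lt_w.ne'] using hS.second_last_rel hy hz w o

theorem a_mul_add (hS : IsReduced S o w p m) {y z : K} (hy : y ∈ J) (hz : z ∈ J) :
    img S o m z o o * y + z * img S o m y m m = 0 := by
  have h := hS.second_last_rel hy hz w m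
  simp only [hS.img_second_last' hz] at h
  simpa [hS.top_w hy, hS.top_w hz, hS.o_lt_w.ne', add_comm] using h

theorem mul_gamma (hS : IsReduced S o w p m) {y z : K} (hy : y ∈ J) (hz : z ∈ J) :
    y * img S o m z m w = 0 := by
  have h := hS.second_last_rel hy hz o o
  simp only [hS.img_second_last' hz] at h
  simpa [hS.o_lt_m.ne, hS.o_lt_w.ne, hS.w_lt_m.ne'] using h

theorem c_mul (hS : IsReduced S o w p m) {y z : K} (hy : y ∈ J) (hz : z ∈ J) :
    img S o m y m o * z = 0 := by
  simpa [hS.o_lt_m.ne', hS.p_lt_m.ne] using hS.first_pred_rel hy hz m p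

theorem alpha_mul (hS : IsReduced S o w p m) {y z : K} (hy : y ∈ J) (hz : z ∈ J) :
    img S o m z p o * y = 0 := by
  have h := hS.first_pred_rel hy hz m m
  simp only [hS.img_first_pred' hz] at h
  simpa [hS.o_lt_m.ne', hS.p_lt_m.ne', hS.o_lt_p.ne] using h

/-- Here y e_{1,n} is paired with z e_{2,2}, whose image has only an entry (n,1). For a = n-1 and a
= n this gives β(y)z = 0 and γ(y)z = 0. -/
theorem mul_second_eq_zero (hS : IsReduced S o w p m) {y z : K} (hy : y ∈ J) (hz : z ∈ J)
    {a : Fin n} (ha : a ≠ w) : img S o m y a w * z = 0 := by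
  have h := img_jordan_zero hS.jordan (fun _ : o ≤ m => hy) (fun _ : w ≤ w => hz) hS.w_lt_m.ne'
    hS.o_lt_w.ne' a w
  rw [hS.img_diag hS.o_lt_w hS.w_lt_m hz, hS.top_w hz] at h
  simpa [ha] using h

theorem pred_mul_eq_zero (hS : IsReduced S o w p m) {y z : K} (hy : y ∈ J) (hz : z ∈ J)
    {b : Fin n} (hb : b ≠ p) : z * img S o m y p b = 0 := by
  have h := img_jordan_zero hS.jordan (fun _ : o ≤ m => hy) (fun _ : p ≤ p => hz) hS.p_lt_m.ne'
    hS.o_lt_p.ne' p b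
  rw [hS.img_diag hS.o_lt_p hS.p_lt_m hz, hS.top_p hz] at h
  simpa [hb] using h

theorem c_sq (hS : IsReduced S o w p m) {y z : K} (hy : y ∈ J) (hz : z ∈ J) :
    img S o m (y * z) m o = 0 := by
  have h := img_jordan_mul hS.jordan (fun _ : o ≤ w => hy) (fun _ : w ≤ m => hz)
    (fun _ => J.mul_mem_left y hz) hS.o_lt_m.ne' m o
  simpa [hS.o_lt_m.ne, hS.o_lt_m.ne', hS.w_lt_m.ne', hS.o_lt_w.ne] using h

end IsReduced

end Relations

/-! ### The almost annihilator and extremal formulas define (Jordan) derivations. -/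

section Extremal

variable {K : Type*} [Ring K] {n : ℕ} {J : Ideal K} [J.IsTwoSided]

theorem entryJ_add (X Y : R n J) (i j : Fin n) (h : i ≤ j) :
    entryJ (X + Y) i j h = entryJ X i j h + entryJ Y i j h := rfl

theorem entryJ_zero (i j : Fin n) (h : i ≤ j) : entryJ (0 : R n J) i j h = 0 := rfl

theorem mul_entry_mem (X Y : R n J) {i j : Fin n} (h : i ≤ j) (k : Fin n) :
    X.1 i k * Y.1 k j ∈ J := by
  rcases le_total i k with hk | hk
  · exact J.mul_mem_right _ (X.2 i k hk)
  · exact J.mul_mem_left _ (Y.2 k j (hk.trans h))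

theorem entryJ_mul (X Y : R n J) (i j : Fin n) (h : i ≤ j) :
    entryJ (X * Y) i j h = ∑ k, ⟨X.1 i k * Y.1 k j, mul_entry_mem X Y h k⟩ := by
  apply Subtype.ext
  rw [AddSubmonoidClass.coe_finsetSum]
  exact Matrix.mul_apply

/-- The formula for an almost annihilator derivation. -/
def almostAnn (hn : 4 ≤ n) (a b : J →+ J) (c : J →+ K) : R n J →+ R n J where
  toFun X := ⟨∑ i, Matrix.single i (ixOne hn) (a (entryJ X i (ixLast hn) (le_ixLast hn i)) : K) +
      ∑ j, Matrix.single (ixLast hn) j (b (entryJ X (ixOne hn) j (ixOne_le hn j)) : K) +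
      Matrix.single (ixLast hn) (ixOne hn)
        (c (entryJ X (ixOne hn) (ixLast hn) (ixOne_le hn _))), by
    refine (R n J).add_mem ((R n J).add_mem ?_ ?_) ?_
    · exact (R n J).sum_mem fun i _ => (elem _ _ _ fun _ => (a _).2).2
    · exact (R n J).sum_mem fun i _ => (elem _ _ _ fun _ => (b _).2).2
    · exact (elem _ _ _ (not_le_imp (isCorner_ix hn).o_lt_m _)).2⟩
  map_zero' := Subtype.ext (by simp [entryJ_zero])
  map_add' X Y := Subtype.ext (by
    simp only [entryJ_add, map_add, NonUnitalSubring.val_add,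
      Submodule.coe_add, Matrix.single_add, Finset.sum_add_distrib]
    abel)

theorem almostAnn_apply (hn : 4 ≤ n) (a b : J →+ J) (c : J →+ K) (X : R n J) (i j : Fin n) :
    (almostAnn hn a b c X).1 i j =
      (if j = ixOne hn then (a (entryJ X i (ixLast hn) (le_ixLast hn i)) : K) else 0) +
      (if i = ixLast hn then (b (entryJ X (ixOne hn) j (ixOne_le hn j)) : K) else 0) +
      (if i = ixLast hn ∧ j = ixOne hn then
        c (entryJ X (ixOne hn) (ixLast hn) (ixOne_le hn _)) else 0) := by
  show (_ + _ + _ : Matrix (Fin n) (Fin n) K) i j = _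
  rw [Matrix.add_apply, Matrix.add_apply, Matrix.sum_apply, Matrix.sum_apply]
  simp only [Matrix.single_apply]
  congr 1
  · congr 1
    · rw [Finset.sum_eq_single i]
      · simp [eq_comm]
      · intro k _ hk; simp [hk]
      · simp
    · rw [Finset.sum_eq_single j]
      · simp [eq_comm]
      · intro k _ hk; simp [hk]
      · simp
  · simp [eq_comm]

/-- Left linearity of a matches the first column of D(XY) with XD(Y), and right linearity of b
matches its last row with D(X)Y. The cross terms a(X_{i,n})Y_{1,j} and X_{i,n}b(Y_{1,j}) cancel, and
all terms with c vanish. -/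
theorem isAlmostAnnihilatorDerivation_almostAnn (hn : 4 ≤ n) {a b : J →+ J} {c : J →+ K}
    (ha : ∀ (x : K) (y : J), (a (mulL x y) : K) = x * a y)
    (hb : ∀ (y : J) (x : K), (b (mulR y x) : K) = b y * x)
    (hc : ∀ y z : J, c y * z = 0 ∧ (y : K) * c z = 0 ∧ c (mulR y z) = 0)
    (hab : ∀ y z : J, (a y : K) * z + y * b z = 0) :
    IsAlmostAnnihilatorDerivation hn (almostAnn hn a b c) := by
  refine ⟨fun X Y => Subtype.ext ?_, a, b, c, ha, hb, hc, hab, fun X => rfl⟩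
  ext i j
  have h1 : (a (entryJ (X * Y) i (ixLast hn) (le_ixLast hn i)) : K) =
      ∑ k, X.1 i k * a (entryJ Y k (ixLast hn) (le_ixLast hn k)) := by
    rw [entryJ_mul, map_sum, AddSubmonoidClass.coe_finsetSum]
    exact Finset.sum_congr rfl fun k _ => ha (X.1 i k) (entryJ Y k (ixLast hn) (le_ixLast hn k))
  have h3 : (b (entryJ (X * Y) (ixOne hn) j (ixOne_le hn j)) : K) =
      ∑ k, b (entryJ X (ixOne hn) k (ixOne_le hn k)) * Y.1 k j := by
    rw [entryJ_mul, map_sum, AddSubmonoidClass.coe_finsetSum]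
    exact Finset.sum_congr rfl fun k _ => hb (entryJ X (ixOne hn) k (ixOne_le hn k)) (Y.1 k j)
  have h4 : c (entryJ (X * Y) (ixOne hn) (ixLast hn) (ixOne_le hn _)) = 0 := by
    rw [entryJ_mul, map_sum]
    exact Finset.sum_eq_zero fun k _ =>
      (hc (entryJ X (ixOne hn) k (ixOne_le hn k)) (entryJ Y k (ixLast hn) (le_ixLast hn k))).2.2
  have h5 : (a (entryJ X i (ixLast hn) (le_ixLast hn i)) : K) * Y.1 (ixOne hn) j +
      X.1 i (ixLast hn) * b (entryJ Y (ixOne hn) j (ixOne_le hn j)) = 0 :=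
    hab _ (entryJ Y (ixOne hn) j (ixOne_le hn j))
  have h6 : c (entryJ X (ixOne hn) (ixLast hn) (ixOne_le hn _)) * Y.1 (ixOne hn) j = 0 :=
    (hc _ (entryJ Y (ixOne hn) j (ixOne_le hn j))).1
  have h7 : X.1 i (ixLast hn) * c (entryJ Y (ixOne hn) (ixLast hn) (ixOne_le hn _)) = 0 :=
    (hc (entryJ X i (ixLast hn) (le_ixLast hn i)) _).2.1
  rw [almostAnn_apply, h1, h3, h4]
  show _ = ((almostAnn hn a b c X).1 * Y.1 + X.1 * (almostAnn hn a b c Y).1) i j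
  rw [Matrix.add_apply, Matrix.mul_apply, Matrix.mul_apply]
  simp only [almostAnn_apply, add_mul, mul_add, ite_mul, mul_ite, zero_mul, mul_zero,
    Finset.sum_add_distrib, Finset.sum_ite_eq', Finset.mem_univ, if_true,
    ite_and]
  rw [h7]
  have key : ∀ s t u v : K, u + v = 0 → s + t = u + t + (s + v) := by
    intro s t u v h
    rw [show u + t + (s + v) = s + t + (u + v) by abel, h, add_zero]
  have k := key (if j = ixOne hn then ∑ k, X.1 i k * a (entryJ Y k (ixLast hn) (le_ixLast hn k))
    else 0) (if i = ixLast hn then ∑ k, b (entryJ X (ixOne hn) k (ixOne_le hn k)) * Y.1 k j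
    else 0) _ _ h5
  by_cases hi : i = ixLast hn <;> by_cases hj : j = ixOne hn <;> subst_vars
  · simpa [h6] using k
  · simpa [hj, h6] using k
  · simpa [hi] using k
  · simpa [hi, hj] using k

/-- The formula for an extremal Jordan derivation. -/
def extremal (hn : 4 ≤ n) (α β γ : J →+ annK J) : R n J →+ R n J where
  toFun X :=
    let y1n : J := entryJ X (ixOne hn) (ixLast hn) (ixOne_le hn _)
    let y1p : J := entryJ X (ixOne hn) (ixPred hn) (ixOne_le hn _)
    let y2p : J := entryJ X (ixTwo hn) (ixPred hn) (ixTwo_le_ixPred hn)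
    let y2n : J := entryJ X (ixTwo hn) (ixLast hn) (le_ixLast hn _)
    ⟨(Matrix.single (ixPred hn) (ixOne hn) (α y1n : K) +
          Matrix.single (ixPred hn) (ixTwo hn) (β y1n : K) +
          Matrix.single (ixLast hn) (ixTwo hn) (γ y1n : K)) +
        (Matrix.single (ixLast hn) (ixOne hn) (α y1p : K) +
          Matrix.single (ixLast hn) (ixTwo hn) (β y1p : K)) +
        Matrix.single (ixLast hn) (ixOne hn) (β y2p : K) +
        (Matrix.single (ixPred hn) (ixOne hn) (β y2n : K) +
          Matrix.single (ixLast hn) (ixOne hn) (γ y2n : K)), by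
      have h1 := (isCorner_ix hn).o_lt_m
      have h3 := (isCorner_ix hn).o_lt_p
      have h4 := (isCorner_ix hn).w_lt_p
      have h5 := (isCorner_ix hn).w_lt_m
      repeat' apply add_mem
      all_goals first
        | exact single_mem h1 _
        | exact single_mem h3 _
        | exact single_mem h4 _
        | exact single_mem h5 _⟩
  map_zero' := Subtype.ext (by simp [entryJ_zero])
  map_add' X Y := Subtype.ext (by
    simp only [entryJ_add, map_add, NonUnitalSubring.val_add, AddSubgroup.coe_add,
      Matrix.single_add]
    abel)

theorem single_mul_of_ann {c : K} (hc : c ∈ annK J) (X : R n J) (i : Fin n) {o : Fin n}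
    (ho : o.1 = 0) : Matrix.single i o c * X.1 = 0 := by
  ext a b
  rw [single_mul_apply', (hc _ (X.2 o b (by rw [Fin.le_def]; omega))).1]
  simp

theorem mul_single_of_ann {c : K} (hc : c ∈ annK J) (X : R n J) (j : Fin n) {m : Fin n}
    (hm : m.1 = n - 1) : X.1 * Matrix.single m j c = 0 := by
  ext a b
  rw [mul_single_apply', (hc _ (X.2 a m (by rw [Fin.le_def]; omega))).2]
  simp

theorem single_second_mul_of_ann {o w p m : Fin n} (hC : IsCorner o w p m) {c : K}
    (hc : c ∈ annK J) (X : R n J) (i : Fin n) :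
    Matrix.single i w c * X.1 = Matrix.single i o (c * X.1 w o) := by
  ext a b
  rw [single_mul_apply', Matrix.single_apply]
  by_cases hb : b = o
  · subst hb; simp [eq_comm]
  · have : w ≤ b := by
      have := hC.o_lt hb
      rw [Fin.lt_def] at this
      rw [Fin.le_def, hC.hw]; omega
    rw [(hc _ (X.2 w b this)).1]
    simp [Ne.symm hb]

theorem mul_single_pred_of_ann {o w p m : Fin n} (hC : IsCorner o w p m) {c : K}
    (hc : c ∈ annK J) (X : R n J) (j : Fin n) :
    X.1 * Matrix.single p j c = Matrix.single m j (X.1 m p * c) := by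
  ext a b
  rw [mul_single_apply', Matrix.single_apply]
  by_cases ha : a = m
  · subst ha; simp [eq_comm]
  · have : a ≤ p := by
      have := hC.lt_m ha
      have := hC.hm
      have := hC.hp
      rw [Fin.le_def]
      rw [Fin.lt_def] at *
      omega
    rw [(hc _ (X.2 a p this)).2]
    simp [Ne.symm ha]

theorem map_entryJ_mul (f : J →+ annK J) (X Y : R n J) {i j : Fin n} (h : i ≤ j) :
    (f (entryJ (X * Y) i j h) : K) =
      ∑ k, (f ⟨X.1 i k * Y.1 k j, mul_entry_mem X Y h k⟩ : K) := by
  rw [entryJ_mul, map_sum, AddSubmonoidClass.coe_finsetSum]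

/-- The map of an extremal Jordan derivation reverses the order of the factors in the Leibniz
rule. -/
theorem extremal_mul (hn : 4 ≤ n) {α β γ : J →+ annK J}
    (hsq : ∀ y z : J, α (mulR y z) = 0 ∧ β (mulR y z) = 0 ∧ γ (mulR y z) = 0)
    (hlin : ∀ (x : K) (y : J), (α (mulR y x) : K) = x * α y ∧ (β (mulR y x) : K) = x * β y ∧
      (β (mulL x y) : K) = β y * x ∧ (γ (mulL x y) : K) = γ y * x) (X Y : R n J) :
    (extremal hn α β γ (X * Y)).1 =
      (extremal hn α β γ Y).1 * X.1 + Y.1 * (extremal hn α β γ X).1 := by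
  have hC := isCorner_ix hn
  -- A summand X_{i,k} Y_{k,j} with i ≤ k ≤ j lies in J² and is killed. In rows 1, 2 and columns
  -- n-1, n this leaves only k = 1 (for row 2) and k = n (for column n-1).
  have hz : ∀ f : J →+ annK J, (∀ y z : J, f (mulR y z) = 0) → ∀ {i k j : Fin n} (h : i ≤ j),
      i ≤ k → k ≤ j → (f ⟨X.1 i k * Y.1 k j, mul_entry_mem X Y h k⟩ : K) = 0 := by
    intro f hf i k j h hik hkj
    have := hf (entryJ X i k hik) (entryJ Y k j hkj)
    exact congrArg Subtype.val this
  have hw : ∀ {k : Fin n}, k ≠ ixOne hn → ixTwo hn ≤ k := by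
    intro k hk
    have := hC.o_lt hk
    rw [Fin.lt_def] at this
    rw [Fin.le_def, hC.hw]; omega
  have hp : ∀ {k : Fin n}, k ≠ ixLast hn → k ≤ ixPred hn := by
    intro k hk
    have := hC.lt_m hk
    rw [Fin.lt_def, hC.hm] at this
    rw [Fin.le_def, hC.hp]; omega
  have e1n : ∀ f : J →+ annK J, (∀ y z : J, f (mulR y z) = 0) →
      (f (entryJ (X * Y) (ixOne hn) (ixLast hn) (ixOne_le hn _)) : K) = 0 := by
    intro f hf
    rw [map_entryJ_mul]
    exact Finset.sum_eq_zero fun k _ => hz f hf (ixOne_le hn _) (ixOne_le hn k) (le_ixLast hn k)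
  have e1p : ∀ f : J →+ annK J, (∀ y z : J, f (mulR y z) = 0) →
      (∀ (x : K) (y : J), (f (mulR y x) : K) = x * f y) →
      (f (entryJ (X * Y) (ixOne hn) (ixPred hn) (ixOne_le hn _)) : K) =
        Y.1 (ixLast hn) (ixPred hn) *
          f (entryJ X (ixOne hn) (ixLast hn) (ixOne_le hn _)) := by
    intro f hf hr
    rw [map_entryJ_mul, Finset.sum_eq_single (ixLast hn)]
    · exact hr _ (entryJ X (ixOne hn) (ixLast hn) (ixOne_le hn _))
    · intro k _ hk
      exact hz f hf (ixOne_le hn _) (ixOne_le hn k) (hp hk)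
    · simp
  have e2n : ∀ f : J →+ annK J, (∀ y z : J, f (mulR y z) = 0) →
      (∀ (x : K) (y : J), (f (mulL x y) : K) = f y * x) →
      (f (entryJ (X * Y) (ixTwo hn) (ixLast hn) (le_ixLast hn _)) : K) =
        f (entryJ Y (ixOne hn) (ixLast hn) (ixOne_le hn _)) *
          X.1 (ixTwo hn) (ixOne hn) := by
    intro f hf hl
    rw [map_entryJ_mul, Finset.sum_eq_single (ixOne hn)]
    · exact hl _ (entryJ Y (ixOne hn) (ixLast hn) (ixOne_le hn _))
    · intro k _ hk
      exact hz f hf (le_ixLast hn _) (hw hk) (le_ixLast hn k)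
    · simp
  have e2p : (β (entryJ (X * Y) (ixTwo hn) (ixPred hn) (ixTwo_le_ixPred hn)) : K) =
        β (entryJ Y (ixOne hn) (ixPred hn) (ixOne_le hn _)) * X.1 (ixTwo hn) (ixOne hn) +
        Y.1 (ixLast hn) (ixPred hn) *
          β (entryJ X (ixTwo hn) (ixLast hn) (le_ixLast hn _)) := by
    rw [map_entryJ_mul, Finset.sum_eq_add (ixOne hn) (ixLast hn) hC.o_lt_m.ne]
    · rw [← (hlin _ _).2.2.1, ← (hlin _ _).2.1]
      rfl
    · intro k _ hk
      exact hz β (fun y z => (hsq y z).2.1) (ixTwo_le_ixPred hn) (hw hk.1) (hp hk.2)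
    · simp
    · simp
  show (_ + _ + _ + (_ + _) + _ + (_ + _) : Matrix (Fin n) (Fin n) K) =
    (_ + _ + _ + (_ + _) + _ + (_ + _)) * X.1 + Y.1 * (_ + _ + _ + (_ + _) + _ + (_ + _))
  rw [e1n α fun y z => (hsq y z).1, e1n β fun y z => (hsq y z).2.1,
    e1n γ fun y z => (hsq y z).2.2,
    e1p α (fun y z => (hsq y z).1) fun x y => (hlin x y).1,
    e1p β (fun y z => (hsq y z).2.1) fun x y => (hlin x y).2.1,
    e2n β (fun y z => (hsq y z).2.1) fun x y => (hlin x y).2.2.1,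
    e2n γ (fun y z => (hsq y z).2.2) fun x y => (hlin x y).2.2.2, e2p]
  simp only [add_mul, mul_add, single_mul_of_ann (Subtype.prop _) X _ hC.ho,
    mul_single_of_ann (Subtype.prop _) Y _ hC.hm,
    single_second_mul_of_ann hC (Subtype.prop _) X,
    mul_single_pred_of_ann hC (Subtype.prop _) Y, Matrix.single_zero, Matrix.single_add]
  abel

/-- Symmetrising in X and Y makes the reversed Leibniz rule agree with the Jordan rule. -/
theorem isExtremalJordanDerivation_extremal (hn : 4 ≤ n) {α β γ : J →+ annK J}
    (hsq : ∀ y z : J, α (mulR y z) = 0 ∧ β (mulR y z) = 0 ∧ γ (mulR y z) = 0)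
    (hlin : ∀ (x : K) (y : J), (α (mulR y x) : K) = x * α y ∧ (β (mulR y x) : K) = x * β y ∧
      (β (mulL x y) : K) = β y * x ∧ (γ (mulL x y) : K) = γ y * x) :
    IsExtremalJordanDerivation hn (extremal hn α β γ) := by
  refine ⟨fun X Y => Subtype.ext ?_, α, β, γ, hsq, hlin, fun X => rfl⟩
  rw [map_add]
  show (extremal hn α β γ (X * Y)).1 + (extremal hn α β γ (Y * X)).1 =
    ((extremal hn α β γ X).1 * Y.1 + Y.1 * (extremal hn α β γ X).1) +
      (X.1 * (extremal hn α β γ Y).1 + (extremal hn α β γ Y).1 * X.1)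
  rw [extremal_mul hn hsq hlin, extremal_mul hn hsq hlin]
  abel

end Extremal

/-! ### Splitting the reduced Jordan derivation and conclusion. -/

section Assembly

variable {K : Type*} [Ring K] {n : ℕ} {J : Ideal K} [J.IsTwoSided]

/-- An entry of the image of `y e_{1,n}`, as an additive function of `y ∈ J`. -/
noncomputable def topEntry (S : R n J →+ R n J) (o m a b : Fin n) : J →+ K :=
  AddMonoidHom.mk' (fun y => img S o m y.1 a b) fun y z =>
    congrFun (congrFun (img_add S (fun _ => y.2) (fun _ => z.2)) a) b

/-- A diagonal entry of the image of `y e_{1,n}`, as an additive function with values in `J`. -/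
noncomputable def topEntryIdeal (S : R n J →+ R n J) (o m a : Fin n) : J →+ J :=
  AddMonoidHom.mk' (fun y => ⟨img S o m y.1 a a, img_mem S _ _ _ le_rfl⟩) fun y z =>
    Subtype.ext ((topEntry S o m a a).map_add y z)

/-- An entry of the image of `y e_{1,n}`, as an additive function with values in `Ann J`. -/
noncomputable def topEntryAnn (S : R n J →+ R n J) (o m a b : Fin n)
    (h : ∀ y ∈ J, img S o m y a b ∈ annK J) : J →+ annK J :=
  AddMonoidHom.mk' (fun y => ⟨img S o m y.1 a b, h y.1 y.2⟩) fun y z =>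
    Subtype.ext ((topEntry S o m a b).map_add y z)

theorem IsReduced.exists_eq_add (hn : 4 ≤ n) {S : R n J →+ R n J}
    (hS : IsReduced S (ixOne hn) (ixTwo hn) (ixPred hn) (ixLast hn)) :
    ∃ Daa Ω : R n J →+ R n J, IsAlmostAnnihilatorDerivation hn Daa ∧
      IsExtremalJordanDerivation hn Ω ∧ S = Daa + Ω := by
  have h1 := hS.o_lt_w.ne
  have h3 := hS.o_lt_p.ne
  have h4 := hS.o_lt_m.ne
  have h5 := hS.w_lt_p.ne
  have h6 := hS.w_lt_m.ne
  have h7 := hS.p_lt_m.ne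
  let α : J →+ annK J :=
    topEntryAnn S (ixOne hn) (ixLast hn) (ixPred hn) (ixOne hn) fun y hy z hz =>
    ⟨hS.alpha_mul hz hy, hS.pred_mul_eq_zero hy hz h3⟩
  let β : J →+ annK J :=
    topEntryAnn S (ixOne hn) (ixLast hn) (ixPred hn) (ixTwo hn) fun y hy z hz =>
    ⟨hS.mul_second_eq_zero hy hz h5.symm, hS.pred_mul_eq_zero hy hz h5⟩
  let γ : J →+ annK J :=
    topEntryAnn S (ixOne hn) (ixLast hn) (ixLast hn) (ixTwo hn) fun y hy z hz =>
    ⟨hS.mul_second_eq_zero hy hz h6.symm, hS.mul_gamma hz hy⟩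
  have haa := isAlmostAnnihilatorDerivation_almostAnn hn
    (a := topEntryIdeal S (ixOne hn) (ixLast hn) (ixOne hn))
    (b := topEntryIdeal S (ixOne hn) (ixLast hn) (ixLast hn))
    (c := topEntry S (ixOne hn) (ixLast hn) (ixLast hn) (ixOne hn))
    (fun x y => hS.a_mul x y.2) (fun y x => hS.b_mul x y.2)
    (fun y z => ⟨hS.c_mul y.2 z.2, hS.mul_c z.2 y.2, hS.c_sq y.2 z.2⟩)
    (fun y z => hS.a_mul_add z.2 y.2)
  have hext := isExtremalJordanDerivation_extremal hn (α := α) (β := β) (γ := γ)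
    -- Vanishing on J² follows from linearity and annihilation, as in α(yz) = zα(y) = 0.
    (fun y z => ⟨Subtype.ext ((hS.mul_pred z y.2 h3).trans (hS.pred_mul_eq_zero y.2 z.2 h3)),
      Subtype.ext ((hS.mul_pred z y.2 h5).trans (hS.pred_mul_eq_zero y.2 z.2 h5)),
      Subtype.ext ((hS.mul_second y.1 z.2 h6.symm).trans
        (hS.mul_second_eq_zero z.2 y.2 h6.symm))⟩)
    (fun x y => ⟨hS.mul_pred x y.2 h3, hS.mul_pred x y.2 h5,
      hS.mul_second x y.2 h5.symm, hS.mul_second x y.2 h6.symm⟩)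
  refine ⟨_, _, haa, hext, ?_⟩
  -- The difference is a Jordan derivation, so by `eq_zero_of_img` it suffices to test it below the
  -- diagonal and on J e_{1,n}.
  rw [← sub_eq_zero, ← sub_sub]
  have hle : ∀ {i j : Fin n} {x : K}, j < i → (i ≤ j → x ∈ J) := fun h => not_le_imp h _
  have hent : ∀ {i j : Fin n} {x : K} (h : i ≤ j → x ∈ J) (a b : Fin n) (hab : a ≤ b),
      ¬ (i = a ∧ j = b) → entryJ (elem i j x h) a b hab = 0 := fun h a b hab hne =>
    Subtype.ext (Matrix.single_apply_of_ne (h := hne) ..)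
  refine eq_zero_of_img hS.two (by omega)
    ((hS.jordan.sub haa.1.isJordanDerivation).sub hext.1) hS.ho hS.hm ?_ ?_
  · intro i j x hji
    have hne : ∀ a b : Fin n, a ≤ b → ¬ (i = a ∧ j = b) := by
      rintro a b hab ⟨rfl, rfl⟩
      exact absurd hji (not_lt.mpr hab)
    rw [img_sub_map, img_sub_map, hS.low hji, img_eq _ (not_le_imp hji x),
      img_eq (extremal hn α β γ) (not_le_imp hji x)]
    have e1 : (almostAnn hn (topEntryIdeal S (ixOne hn) (ixLast hn) (ixOne hn))
        (topEntryIdeal S (ixOne hn) (ixLast hn) (ixLast hn))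
        (topEntry S (ixOne hn) (ixLast hn) (ixLast hn) (ixOne hn))
        (elem i j x (not_le_imp hji x))).1 = 0 := by
      ext a b
      rw [almostAnn_apply, hent _ _ _ _ (hne _ _ (le_ixLast hn a)),
        hent _ _ _ _ (hne _ _ (ixOne_le hn b)), hent _ _ _ _ (hne _ _ (ixOne_le hn _))]
      simp
    have e2 : (extremal hn α β γ (elem i j x (not_le_imp hji x))).1 = 0 := by
      show (_ + _ + _ + (_ + _) + _ + (_ + _) : Matrix (Fin n) (Fin n) K) = 0
      rw [hent _ _ _ _ (hne _ _ (ixOne_le hn (ixLast hn))),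
        hent _ _ _ _ (hne _ _ (ixOne_le hn (ixPred hn))),
        hent _ _ _ _ (hne _ _ (ixTwo_le_ixPred hn)),
        hent _ _ _ _ (hne _ _ (le_ixLast hn (ixTwo hn)))]
      simp
    rw [e1, e2]
    simp
  · intro y hy
    have htop : entryJ (elem (ixOne hn) (ixLast hn) y (fun _ => hy)) (ixOne hn) (ixLast hn)
        (ixOne_le hn _) = ⟨y, hy⟩ := Subtype.ext (Matrix.single_apply_same ..)
    rw [img_sub_map, img_sub_map, sub_sub, sub_eq_zero]
    rw [img_eq (almostAnn hn _ _ _) (fun _ => hy), img_eq (extremal hn α β γ) (fun _ => hy)]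
    have e1 : ∀ a b, (almostAnn hn (topEntryIdeal S (ixOne hn) (ixLast hn) (ixOne hn))
        (topEntryIdeal S (ixOne hn) (ixLast hn) (ixLast hn))
        (topEntry S (ixOne hn) (ixLast hn) (ixLast hn) (ixOne hn))
        (elem (ixOne hn) (ixLast hn) y (fun _ => hy))).1 a b =
        (if a = ixOne hn ∧ b = ixOne hn then
          img S (ixOne hn) (ixLast hn) y (ixOne hn) (ixOne hn) else 0) +
        (if a = ixLast hn ∧ b = ixLast hn then
          img S (ixOne hn) (ixLast hn) y (ixLast hn) (ixLast hn) else 0) +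
        (if a = ixLast hn ∧ b = ixOne hn then
          img S (ixOne hn) (ixLast hn) y (ixLast hn) (ixOne hn) else 0) := by
      intro a b
      rw [almostAnn_apply]
      congr 1
      · congr 1
        · by_cases ha : a = ixOne hn
          · subst ha
            rw [htop]
            simp [topEntryIdeal]
          · rw [hent _ _ _ _ (fun h => ha h.1.symm)]
            simp [ha]
        · by_cases hb : b = ixLast hn
          · subst hb
            rw [htop]
            simp [topEntryIdeal]
          · rw [hent _ _ _ _ (fun h => hb h.2.symm)]
            simp [hb]
      · rw [htop]; rfl
    have e2 : (extremal hn α β γ (elem (ixOne hn) (ixLast hn) y (fun _ => hy))).1 =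
        Matrix.single (ixPred hn) (ixOne hn)
          (img S (ixOne hn) (ixLast hn) y (ixPred hn) (ixOne hn)) +
        Matrix.single (ixPred hn) (ixTwo hn)
          (img S (ixOne hn) (ixLast hn) y (ixPred hn) (ixTwo hn)) +
        Matrix.single (ixLast hn) (ixTwo hn)
          (img S (ixOne hn) (ixLast hn) y (ixLast hn) (ixTwo hn)) := by
      show (_ + _ + _ + (_ + _) + _ + (_ + _) : Matrix (Fin n) (Fin n) K) = _
      rw [htop, hent _ _ _ _ (fun h => h7 h.2.symm), hent _ _ _ _ (fun h => h1 h.1),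
        hent _ _ _ _ (fun h => h1 h.1)]
      simp only [map_zero, ZeroMemClass.coe_zero, Matrix.single_zero, add_zero]
      rfl
    ext a b
    rw [Matrix.add_apply, e1, e2]
    simp only [Matrix.add_apply, Matrix.single_apply]
    have ht := hS.top hy (a := a) (b := b)
    grind

end Assembly

end JordanDer

theorem theorem3p1 {K : Type*} [Ring K] (h2 : ∀ x : K, 2 * x = 0 → x = 0)
    (J : Ideal K) [J.IsTwoSided] (n : ℕ) (hn : 4 ≤ n)
    (Δ : JordanDer.R n J →+ JordanDer.R n J) (hΔ : JordanDer.IsJordanDerivation Δ) :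
    ∃ D Ω : JordanDer.R n J →+ JordanDer.R n J,
      Δ = D + Ω ∧
      JordanDer.IsDerivation D ∧
      JordanDer.IsExtremalJordanDerivation hn Ω ∧
      ∃ Ddiag Dinn Dann Dring Daa : JordanDer.R n J →+ JordanDer.R n J,
        JordanDer.IsDiagonalDerivation Ddiag ∧
        JordanDer.IsInnerDerivation Dinn ∧
        JordanDer.IsAnnihilatorDerivation hn Dann ∧
        JordanDer.IsRingInducedDerivation Dring ∧
        JordanDer.IsAlmostAnnihilatorDerivation hn Daa ∧
        D = Ddiag + Dinn + Dann + Dring + Daa := by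
  obtain ⟨Dinn, Ddiag, hinn, hdiag, hS⟩ :=
    JordanDer.exists_isNormalized h2 hΔ (JordanDer.isCorner_ix hn)
  obtain ⟨Dring, Dann, hring, hann, hS'⟩ := hS.exists_isReduced hn
  obtain ⟨Daa, Ω, haa, hΩ, heq⟩ := hS'.exists_eq_add hn
  refine ⟨Ddiag + Dinn + Dann + Dring + Daa, Ω, ?_, ?_, hΩ, Ddiag, Dinn, Dann, Dring, Daa,
    hdiag, hinn, hann, hring, haa, rfl⟩
  · have e : Δ = Δ - Dinn - Ddiag - Dring - Dann + Dinn + Ddiag + Dring + Dann := by abel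
    rw [e, heq]
    abel
  · exact (((hdiag.1.add hinn.1).add hann.1).add hring.1).add haa.1
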